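/- **Protocol and network.** Nodes run the idealized proof-of-stake longest chain protocol in slots $1,\dots,T_{\mathrm{hor}}$ of duration $\tau=\Delta_{\mathrm h}+K/C$ seconds, where $\Delta_{\mathrm h}\ge 0$ bounds the delay of block headers, $C>0$ is the download bandwidth in block contents per second, and $K\in\mathbb N$ is the resulting number of block contents that a node can download per slot. A static adversary controls at most a fraction $\beta$ of the nodes. At the beginning of a slot every honest node that is eligible in this slot proposes one block on top of its longest fully downloaded valid chain; the block contains pending transactions that the node has received, is semantically valid, and omits no received pending transaction that could still be validly appended. The header commits to the content (the hash is idealized as injective). A header chain is valid if every block was produced by a node eligible in the slot of the block and the slots strictly increase along the chain; adversarial nodes may use each of their present or past eligible slots to produce arbitrarily many blocks on arbitrary valid chains, with arbitrary content. Header chains that honest nodes broadcast or relay reach all honest nodes within $\Delta_{\mathrm h}$. Contents are held in a repository; from time $\Delta_{\mathrm h}$ after the beginning of a slot until its end, every honest node keeps requesting contents according to its download rule, and at most $K$ requests are served per slot. A content is processed once the header chain is known and all earlier blocks of the chain are downloaded and valid; it is marked invalid if it is not semantically valid. The adversary schedules all events, may withhold contents, may push valid header chains and contents to honest nodes at any time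 irrespective of delay and bandwidth, and breaks all ties. *Download towards the freshest block:* among the header chains in the node's header tree without a block of invalid content, take one whose last block has the most recent slot, and request the first block on it whose content is unknown (nothing, if there is none). With confirmation latency $T_{\mathrm{conf}}\in\mathbb N$, node $i$ outputs at the end of slot $t$ the ledger $\mathsf{LOG}_i^t$ of all transactions, in order, in the blocks with slot at most $t-T_{\mathrm{conf}}$ (and the genesis block) of its longest downloaded chain. **Executions.** An execution is the family $(H_t,A_t)_{1\le t\le T_{\mathrm{hor}}}$ of the numbers of honest and adversarial nodes eligible in slot $t$; all of these are independent, $H_t\sim\mathrm{Poisson}((1-\beta)\rho)$ and $A_t\sim\mathrm{Poisson}(\beta\rho)$. In a given execution, * *safety* holds if for all adversarial strategies, all slots $t,t'\le T_{\mathrm{hor}}$ and all honest nodes $i,j$, one of $\mathsf{LOG}_i^t,\mathsf{LOG}_j^{t'}$ is a prefix of the other, and likewise for the underlying truncated chains; * *liveness with parameter* $T_{\mathrm{live}}$ holds if for all adversarial strategies: if a transaction is received by all honest nodes before slot $t$ and, in slots $t,\dots,t+T_{\mathrm{live}}$, does not become semantically invalid with respect to chains ending in a newly proposed honest block that do not contain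 it, then it is in $\mathsf{LOG}_i^{t'}$ for all honest $i$ and all $t'$ with $t+T_{\mathrm{live}}\le t'\le T_{\mathrm{hor}}$. A function $f$ is *negligible* if for every integer $n>0$, $f(\kappa)<\kappa^{-n}$ for all sufficiently large $\kappa$. **Corollary.** Let $\beta\in[0,1)$, $\rho>0$ and $\epsilon_1\in(0,1)$ satisfy $$(1-\beta)\rho e^{-\rho}=\frac{1-e^{-\rho}}2(1+\epsilon_1),$$ and let $\Delta_{\mathrm h}\ge 0$, $C>0$. There are constants $c_\tau,c_T>0$ and a negligible function $\mathrm{negl}$, depending only on $\beta,\rho,\epsilon_1,\Delta_{\mathrm h},C$, such that the following holds for all $\kappa,T_{\mathrm{hor}},K,T_{\mathrm{conf}},T_{\mathrm{live}}\in\mathbb N$ with $T_{\mathrm{hor}}\ge 1$. If $$\tau=\Delta_{\mathrm h}+\tfrac KC\ \ge\ c_\tau(\kappa+\ln T_{\mathrm{hor}}),\qquad T_{\mathrm{conf}}\ \ge\ c_T(\kappa+\ln T_{\mathrm{hor}})^2,\qquad T_{\mathrm{live}}\ \ge\ T_{\mathrm{conf}}+c_T(\kappa+\ln T_{\mathrm{hor}})^2,$$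 then, with probability at least $1-\mathrm{negl}(\kappa)$ over the execution, the protocol with the "download towards the freshest block" rule satisfies safety and liveness with parameter $T_{\mathrm{live}}$ over the time horizon $T_{\mathrm{hor}}$. -/

import Mathlib

noncomputable section

namespace PoSLC

/-! ## Blocks, header chains, ledgers -/

/-- A block header: production slot, producing node, and the commitment to the block content. -/
structure Header (Digest : Type*) where
  time : ℕ
  node : ℕ
  txsHash : Digest

/-- A header chain, oldest header first; the genesis block is implicit, so `[]` is the genesis
header chain. The length of a chain is its list length, `C' <+: C` says that `C'` is a prefix. -/
abbrev Chain (Digest : Type*) := List (Header Digest)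

/-- The slot of the last block of a chain (the genesis block has slot `0`). -/
def tipTime {Digest : Type*} (C : Chain Digest) : ℕ :=
  (C.getLast?.map Header.time).getD 0

/-- What a node knows about the content of a block. -/
inductive Status (Tx : Type*) where
  | unknown
  | invalid
  | known (txs : List Tx)

/-- The transactions of a block whose content is known (none otherwise). -/
def Status.txs {Tx : Type*} : Status Tx → List Tx
  | .known l => l
  | _ => []

/-- The mapping `blkTxs`; the block at the tip of a chain is identified with that chain. -/
abbrev Contents (Tx Digest : Type*) := Chain Digest → Status Tx

/-- The block at the tip of `C` is downloaded and its content is valid. -/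
def Downloaded {Tx Digest : Type*} (blk : Contents Tx Digest) (C : Chain Digest) : Prop :=
  ∃ txs, blk C = .known txs

/-- The list of transactions as ordered in the blocks of `C`, genesis block included. -/
def ledger {Tx Digest : Type*} (blk : Contents Tx Digest) (C : Chain Digest) : List Tx :=
  C.inits.flatMap fun C' => (blk C').txs

/-- The transactions of the given list are, one after the other, semantically valid with respect
to the ledger `L` extended by the earlier ones. -/
def SemValid {Tx : Type*} (valid : List Tx → Tx → Prop) : List Tx → List Tx → Prop
  | _, [] => True
  | L, x :: xs => valid L x ∧ SemValid valid (L ++ [x]) xs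

/-- `C` truncated at slot `t` with confirmation latency `Tconf`: the prefix of the blocks with time
slot at most `t - Tconf`. (Time slots increase along a valid chain.) -/
def truncate {Digest : Type*} (Tconf t : ℕ) (C : Chain Digest) : Chain Digest :=
  C.takeWhile fun h => decide (h.time + Tconf ≤ t)

/-! ## Download rules -/

/-- A download rule. `rule hT blk r` says that, with header tree `hT` and contents `blk`, the rule
can return `r` under some way of breaking ties; `none` means that nothing is requested. -/
abbrev DownloadRule (Tx Digest : Type*) :=
  Set (Chain Digest) → Contents Tx Digest → Option (Chain Digest) → Prop

/-- The header chains of `hT` that contain no block with invalid content. -/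
def candidates {Tx Digest : Type*} (hT : Set (Chain Digest)) (blk : Contents Tx Digest) :
    Set (Chain Digest) :=
  {C | C ∈ hT ∧ ∀ C', C' <+: C → blk C' ≠ .invalid}

/-- `C` is a candidate whose tip comes from the most recent slot. -/
def IsFreshest {Tx Digest : Type*} (hT : Set (Chain Digest)) (blk : Contents Tx Digest)
    (C : Chain Digest) : Prop :=
  C ∈ candidates hT blk ∧ ∀ C' ∈ candidates hT blk, tipTime C' ≤ tipTime C

/-- `r` is the first block of `C` with unknown content, or `none` if there is no such block. -/
def IsFirstUnknown {Tx Digest : Type*} (blk : Contents Tx Digest) (C : Chain Digest) :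
    Option (Chain Digest) → Prop
  | none => ∀ C', C' <+: C → blk C' ≠ .unknown
  | some D => D <+: C ∧ blk D = .unknown ∧
      ∀ C', C' <+: C → blk C' = .unknown → D.length ≤ C'.length

/-- The rule `download towards the freshest block`. -/
def freshestBlockRule (Tx Digest : Type*) : DownloadRule Tx Digest :=
  fun hT blk r => ∃ C, IsFreshest hT blk C ∧ IsFirstUnknown blk C r

/-! ## Protocol, network and system parameters -/

/-- Parameters of the protocol and of the network. `headerDelay` is the bound (in seconds) on the
delay of headers, `bandwidth` is in block contents per second, `slotCapacity` is the number of block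
contents that a node can download in one slot, `Tconf` is the confirmation latency in slots. -/
structure Params (Tx Digest : Type*) where
  headerDelay : ℝ
  bandwidth : ℝ
  slotCapacity : ℕ
  Tconf : ℕ
  hash : List Tx → Digest
  valid : List Tx → Tx → Prop
  genesisTxs : List Tx
  rule : DownloadRule Tx Digest

/-- The slot duration in seconds, as a function of header delay, bandwidth and slot capacity. -/
def slotDuration (headerDelay bandwidth : ℝ) (slotCapacity : ℕ) : ℝ :=
  headerDelay + slotCapacity / bandwidth

/-- The slot duration `τ`. -/
def Params.slot {Tx Digest : Type*} (p : Params Tx Digest) : ℝ :=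
  slotDuration p.headerDelay p.bandwidth p.slotCapacity

/-- The nodes, the outcome of the block production lottery, and the transactions that the nodes
receive: `leader P t` says that node `P` may produce blocks for slot `t`, and `pool P t` is the set
of transactions received by `P` before slot `t`. -/
structure System (Tx : Type*) where
  honest : Finset ℕ
  corrupt : Finset ℕ
  leader : ℕ → ℕ → Prop
  pool : ℕ → ℕ → Finset Tx

/-- The local state of an honest node: header tree, longest downloaded chain, block contents, and
the number of requested contents delivered to it so far in the current slot. -/
structure NodeState (Tx Digest : Type*) where
  headers : Set (Chain Digest)
  longest : Chain Digest
  blkTxs : Contents Tx Digest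
  served : ℕ

/-- The global state. `tree` is the set of valid header chains, `repo` is the repository of
contents, `sent` holds the header chains broadcast by honest nodes with the time of broadcast. -/
structure State (Tx Digest : Type*) where
  clock : ℝ
  slot : ℕ
  tree : Set (Chain Digest)
  repo : Set (Chain Digest × List Tx)
  sent : Set (Chain Digest × ℝ)
  node : ℕ → NodeState Tx Digest

open Classical in
def initialNode {Tx Digest : Type*} (p : Params Tx Digest) : NodeState Tx Digest where
  headers := {[]}
  longest := []
  blkTxs := fun C => if C = [] then .known p.genesisTxs else .unknown
  served := 0

def initialState {Tx Digest : Type*} (p : Params Tx Digest) : State Tx Digest where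
  clock := 0
  slot := 0
  tree := {[]}
  repo := ∅
  sent := ∅
  node := fun _ => initialNode p

/-! ## Events -/

/-- The header at the tip of `C` commits to `txs`. -/
def Commits {Tx Digest : Type*} (p : Params Tx Digest) (C : Chain Digest) (txs : List Tx) : Prop :=
  C.getLast?.map Header.txsHash = some (p.hash txs)

/-- Node `P` receives the header chain `C`, adds it with its prefixes to its header tree, and
broadcasts it. -/
def State.receiveHeader {Tx Digest : Type*} (s : State Tx Digest) (P : ℕ) (C : Chain Digest) :
    State Tx Digest :=
  { s with
    node := Function.update s.node P
      { s.node P with headers := (s.node P).headers ∪ {C' | C' <+: C} }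
    sent := insert (C, s.clock) s.sent }

/-- `C` is a longest chain among the downloaded valid chains. -/
def IsLongest {Tx Digest : Type*} (hT : Set (Chain Digest)) (blk : Contents Tx Digest)
    (C : Chain Digest) : Prop :=
  C ∈ hT ∧ Downloaded blk C ∧ ∀ C' ∈ hT, Downloaded blk C' → C'.length ≤ C.length

/-- A node processes the content `txs` of the block at the tip of `C` only when it has the header
chain, the contents of all proper prefixes are downloaded and valid, and `txs` matches the header.
(Content that arrives earlier is deferred by the node until this holds.) -/
def CanProcess {Tx Digest : Type*} (p : Params Tx Digest) (n : NodeState Tx Digest)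
    (C : Chain Digest) (txs : List Tx) : Prop :=
  C ∈ n.headers ∧ (∀ C', C' <+: C → C' ≠ C → Downloaded n.blkTxs C') ∧ Commits p C txs

open Classical in
/-- The contents after `txs` has been processed: valid content is stored, otherwise the block is
marked as invalid. -/
def processed {Tx Digest : Type*} (p : Params Tx Digest) (blk : Contents Tx Digest)
    (C : Chain Digest) (txs : List Tx) : Contents Tx Digest :=
  Function.update blk C
    (if SemValid p.valid (ledger blk C.dropLast) txs then .known txs else .invalid)

/-- The state after node `P` has processed the content `txs` of `C`, where `D` is its new longest
downloaded chain and `k` its new count of delivered requests. Valid content is uploaded to the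
repository. -/
def State.receiveContent {Tx Digest : Type*} (p : Params Tx Digest) (s : State Tx Digest) (P : ℕ)
    (C : Chain Digest) (txs : List Tx) (D : Chain Digest) (k : ℕ) : State Tx Digest :=
  { s with
    node := Function.update s.node P
      { s.node P with
        blkTxs := processed p (s.node P).blkTxs C txs
        longest := D
        served := k }
    repo := s.repo ∪
      {x | x = (C, txs) ∧ SemValid p.valid (ledger (s.node P).blkTxs C.dropLast) txs} }

/-- The events within a slot. They are scheduled by the adversary, who also breaks all ties. -/
inductive Step {Tx Digest : Type*} (p : Params Tx Digest) (sys : System Tx) :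
    State Tx Digest → State Tx Digest → Prop
  /-- Time passes, up to the end of the slot; a header chain that was broadcast by an honest node
  reaches every honest node within the header delay. -/
  | tick (s : State Tx Digest) (y : ℝ) :
      s.clock ≤ y → y ≤ s.slot * p.slot →
      (∀ C x, (C, x) ∈ s.sent → x + p.headerDelay < y →
        ∀ P ∈ sys.honest, C ∈ (s.node P).headers) →
      Step p sys s { s with clock := y }
  /-- An honest node receives a valid header chain, from the network or from the adversary. -/
  | receiveHeader (s : State Tx Digest) (P : ℕ) (C : Chain Digest) :
      P ∈ sys.honest → C ∈ s.tree → Step p sys s (s.receiveHeader P C)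
  /-- The adversary pushes some content to an honest node, irrespective of bandwidth. -/
  | pushContent (s : State Tx Digest) (P : ℕ) (C : Chain Digest) (txs : List Tx)
      (D : Chain Digest) :
      P ∈ sys.honest → CanProcess p (s.node P) C txs →
      IsLongest (s.node P).headers (processed p (s.node P).blkTxs C txs) D →
      Step p sys s (s.receiveContent p P C txs D (s.node P).served)
  /-- An honest node obtains from the repository a content that it requests according to the
  download rule. Downloads start after the header delay, at most `slotCapacity` per slot. -/
  | download (s : State Tx Digest) (P : ℕ) (C : Chain Digest) (txs : List Tx)
      (D : Chain Digest) :
      P ∈ sys.honest → ((s.slot : ℝ) - 1) * p.slot + p.headerDelay < s.clock →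
      p.rule (s.node P).headers (s.node P).blkTxs (some C) → (C, txs) ∈ s.repo →
      (s.node P).served < p.slotCapacity → CanProcess p (s.node P) C txs →
      IsLongest (s.node P).headers (processed p (s.node P).blkTxs C txs) D →
      Step p sys s (s.receiveContent p P C txs D ((s.node P).served + 1))
  /-- A corrupt node produces a block for a present or past slot `t` for which it is a leader,
  extending any valid header chain with an earlier tip; it may do so repeatedly. -/
  | produce (s : State Tx Digest) (P t : ℕ) (C : Chain Digest) (txs : List Tx) :
      P ∈ sys.corrupt → sys.leader P t → C ∈ s.tree → tipTime C < t → t ≤ s.slot →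
      Step p sys s { s with tree := insert (C ++ [⟨t, P, p.hash txs⟩]) s.tree }
  /-- The adversary uploads some content to the repository. -/
  | upload (s : State Tx Digest) (C : Chain Digest) (txs : List Tx) :
      Commits p C txs → Step p sys s { s with repo := insert (C, txs) s.repo }

/-! ## Slots and runs -/

/-- The ledger of node `P` in state `s`, up to the tip of its longest downloaded chain. -/
def State.ledgerOf {Tx Digest : Type*} (s : State Tx Digest) (P : ℕ) : List Tx :=
  ledger (s.node P).blkTxs (s.node P).longest

/-- The header chain with which node `P`, using content `txs`, extends its longest downloaded chain
at the beginning of slot `s.slot + 1`. -/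
def proposal {Tx Digest : Type*} (p : Params Tx Digest) (s : State Tx Digest) (P : ℕ)
    (txs : List Tx) : Chain Digest :=
  (s.node P).longest ++ [⟨s.slot + 1, P, p.hash txs⟩]

/-- The content `txs` is admissible for a block by node `P` in slot `s.slot + 1`: it consists of
transactions received before that slot and not yet in the ledger of `P`, it is semantically valid,
and it leaves out no such pending transaction that could still be appended. -/
def ProposalContent {Tx Digest : Type*} (p : Params Tx Digest) (sys : System Tx)
    (s : State Tx Digest) (P : ℕ) (txs : List Tx) : Prop :=
  (∀ x ∈ txs, x ∈ sys.pool P (s.slot + 1) ∧ x ∉ s.ledgerOf P) ∧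
  SemValid p.valid (s.ledgerOf P) txs ∧
  ∀ x ∈ sys.pool P (s.slot + 1),
    x ∈ s.ledgerOf P ++ txs ∨ ¬ p.valid (s.ledgerOf P ++ txs) x

/-- The beginning of the next slot: every honest leader proposes a block on top of its longest
downloaded chain (with content `txs P`), uploads the content and broadcasts the header chain. -/
def State.startSlot {Tx Digest : Type*} (p : Params Tx Digest) (sys : System Tx)
    (s : State Tx Digest) (txs : ℕ → List Tx) : State Tx Digest where
  clock := s.clock
  slot := s.slot + 1
  tree := s.tree ∪
    {C | ∃ P ∈ sys.honest, sys.leader P (s.slot + 1) ∧ C = proposal p s P (txs P)}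
  repo := s.repo ∪
    {x | ∃ P ∈ sys.honest, sys.leader P (s.slot + 1) ∧ x = (proposal p s P (txs P), txs P)}
  sent := s.sent ∪
    {x | ∃ P ∈ sys.honest, sys.leader P (s.slot + 1) ∧ x = (proposal p s P (txs P), s.clock)}
  node := fun P => { s.node P with served := 0 }

/-- The end of the slot. Honest nodes request contents until the slot ends, so that each of them has
been served `slotCapacity` contents, or its download rule (with ties broken by the adversary)
requests nothing or a content that the repository does not hold. -/
def State.AtSlotEnd {Tx Digest : Type*} (p : Params Tx Digest) (sys : System Tx)
    (s : State Tx Digest) : Prop :=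
  s.clock = s.slot * p.slot ∧
  ∀ P ∈ sys.honest, (s.node P).served = p.slotCapacity ∨
    ∃ r, p.rule (s.node P).headers (s.node P).blkTxs r ∧
      ∀ C txs, r = some C → (C, txs) ∉ s.repo

/-- A run over the slots `1, …, horizon`, under an arbitrary adversarial strategy. `state t` is the
state at the end of slot `t`, and `txs t P` is the content of the block proposed by the honest node
`P` in slot `t` (if it is a leader). -/
structure Run {Tx Digest : Type*} (p : Params Tx Digest) (sys : System Tx) (horizon : ℕ) where
  state : ℕ → State Tx Digest
  txs : ℕ → ℕ → List Tx
  init : state 0 = initialState p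
  proposals : ∀ t < horizon, ∀ P ∈ sys.honest, sys.leader P (t + 1) →
    ProposalContent p sys (state t) P (txs (t + 1) P)
  steps : ∀ t < horizon, Relation.ReflTransGen (Step p sys)
    ((state t).startSlot p sys (txs (t + 1))) (state (t + 1))
  ends : ∀ t < horizon, (state (t + 1)).AtSlotEnd p sys

/-! ## Security -/

/-- The chain confirmed by node `i` at the end of slot `t`. -/
def Run.confirmed {Tx Digest : Type*} {p : Params Tx Digest} {sys : System Tx} {horizon : ℕ}
    (R : Run p sys horizon) (i t : ℕ) : Chain Digest :=
  truncate p.Tconf t ((R.state t).node i).longest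

/-- The ledger output by node `i` at the end of slot `t`. -/
def Run.LOG {Tx Digest : Type*} {p : Params Tx Digest} {sys : System Tx} {horizon : ℕ}
    (R : Run p sys horizon) (i t : ℕ) : List Tx :=
  ledger ((R.state t).node i).blkTxs (R.confirmed i t)

/-- Safety: any two confirmed chains are prefixes of one another, and so are the ledgers. -/
def Run.Safe {Tx Digest : Type*} {p : Params Tx Digest} {sys : System Tx} {horizon : ℕ}
    (R : Run p sys horizon) : Prop :=
  ∀ t ≤ horizon, ∀ t' ≤ horizon, ∀ i ∈ sys.honest, ∀ j ∈ sys.honest,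
    (R.confirmed i t <+: R.confirmed j t' ∨ R.confirmed j t' <+: R.confirmed i t) ∧
    (R.LOG i t <+: R.LOG j t' ∨ R.LOG j t' <+: R.LOG i t)

/-- In the slots `t, …, t + Tlive`, the transaction `x` does not become invalid before it is
included: with respect to the ledger up to and including a block proposed by an honest node, `x` is
either contained in it or semantically valid. -/
def Run.RemainsValid {Tx Digest : Type*} {p : Params Tx Digest} {sys : System Tx} {horizon : ℕ}
    (R : Run p sys horizon) (Tlive t : ℕ) (x : Tx) : Prop :=
  ∀ s < horizon, t ≤ s + 1 → s + 1 ≤ t + Tlive → ∀ P ∈ sys.honest, sys.leader P (s + 1) →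
    x ∈ (R.state s).ledgerOf P ++ R.txs (s + 1) P ∨
    p.valid ((R.state s).ledgerOf P ++ R.txs (s + 1) P) x

/-- Liveness with parameter `Tlive`. -/
def Run.Live {Tx Digest : Type*} {p : Params Tx Digest} {sys : System Tx} {horizon : ℕ}
    (R : Run p sys horizon) (Tlive : ℕ) : Prop :=
  ∀ (x : Tx) (t : ℕ), (∀ i ∈ sys.honest, x ∈ sys.pool i t) → R.RemainsValid Tlive t x →
    ∀ i ∈ sys.honest, ∀ t' ≤ horizon, t + Tlive ≤ t' → x ∈ R.LOG i t'

/-- An execution: the numbers `(H_t, A_t)` of honest and adversarial nodes that are eligible to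
propose a block in slot `t`; the entry with index `k` belongs to slot `k + 1`. -/
abbrev Execution (horizon : ℕ) := Fin horizon → ℕ × ℕ

/-- The law of the execution: all `H_t` and `A_t` are independent, `H_t` is Poisson with mean
`(1 - β) ρ` and `A_t` is Poisson with mean `β ρ`. -/
def executionLaw (β ρ : ℝ) (horizon : ℕ) : MeasureTheory.Measure (Execution horizon) :=
  MeasureTheory.Measure.pi fun _ =>
    (ProbabilityTheory.poissonMeasure (Real.toNNReal ((1 - β) * ρ))).prod
      (ProbabilityTheory.poissonMeasure (Real.toNNReal (β * ρ)))

/-- The system is admissible in the execution `e`: at most a fraction `β` of the nodes is corrupt,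
the lottery has the numbers of honest and adversarial leaders given by `e`, and nodes do not forget
transactions. -/
structure System.Admissible {Tx : Type*} (sys : System Tx) (β : ℝ) {horizon : ℕ}
    (e : Execution horizon) : Prop where
  disjoint : Disjoint sys.honest sys.corrupt
  fraction : (sys.corrupt.card : ℝ) ≤ β * (sys.honest.card + sys.corrupt.card)
  honestLeaders : ∀ k : Fin horizon,
    {P | P ∈ sys.honest ∧ sys.leader P (k + 1)}.ncard = (e k).1
  corruptLeaders : ∀ k : Fin horizon,
    {P | P ∈ sys.corrupt ∧ sys.leader P (k + 1)}.ncard = (e k).2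
  pool_mono : ∀ P s t, s ≤ t → sys.pool P s ⊆ sys.pool P t

/-- In the execution `e`, safety and liveness hold for all adversarial strategies. -/
def SafeAndLive {Tx Digest : Type*} (p : Params Tx Digest) (β : ℝ) (Tlive : ℕ) {horizon : ℕ}
    (e : Execution horizon) : Prop :=
  ∀ sys : System Tx, sys.Admissible β e → ∀ R : Run p sys horizon, R.Safe ∧ R.Live Tlive

/-- Negligible functions of the security parameter. -/
def Negligible (f : ℕ → ℝ) : Prop :=
  ∀ n : ℕ, 0 < n → ∃ κ₀ : ℕ, ∀ κ : ℕ, κ₀ < κ → f κ < 1 / (κ : ℝ) ^ n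

end PoSLC

end

/-! Give each slot the step `1` if its only eligible node is honest, `0` if nobody is eligible, and
`-1` otherwise. A pivot is a slot such that every interval of slots around it, up to the horizon,
has positive sum. The proof has a deterministic half and a probabilistic half, joined by the event
`PivotDense`: every window of `w` slots contains a pivot.

Deterministic half. In a slot with a unique honest leader, its proposal is the only block of the
newest slot and is valid, so the freshest-block rule requests only blocks of that chain. A node
missing at most `K` of them finishes the download within the slot (`Run.downloaded_block`). If all
such proposals are downloaded promptly, each of these slots lengthens the honest chains, whereas a
chain avoiding their blocks gains at most one block per slot of step `-1`. A chain that drops the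
block of a pivot would therefore be too short to be longest (`Run.block_prefix`).

Promptness in turn follows from pivots by induction on slots (`Run.prompt`): with `w ≤ K`, the
newest proposal contains a recent pivot block that every honest node already has, so at most `w`
blocks are missing. Safety and liveness then use one pivot each: a pivot block common to two longest
chains makes their truncations agree, and a pivot block after the arrival of a transaction carries
it into the ledger.

Probabilistic half. The walk has i.i.d. steps and upward drift. An automaton reads it once,
proposing a new strict maximum as candidate pivot and dropping it when the walk falls below it. An
exponential potential of its state contracts by a factor `γ < 1` per step, so having no candidate
long after `a` is exponentially unlikely (`measure_isSearch_le`); a union bound over start and end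
times gives `PivotDense` for `w` linear in `κ + log T`. -/

noncomputable section

namespace PoSLC

/-! ### Header chains and the contents they commit to -/

section ChainLemmas

variable {Tx Digest : Type*}

theorem prefix_dropLast_of_ne {α : Type*} {D C : List α} (h : D <+: C) (hne : D ≠ C) :
    D <+: C.dropLast := by
  refine List.prefix_of_prefix_length_le h (List.dropLast_prefix C) ?_
  have h1 := h.length_le
  have h2 : D.length ≠ C.length := fun e => hne (h.eq_of_length e)
  rw [List.length_dropLast]; omega

theorem dropLast_ne_of_ne_nil {α : Type*} {C : List α} (h : C ≠ []) : C.dropLast ≠ C := by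
  intro e
  have := congrArg List.length e
  have h2 := List.length_pos_of_ne_nil h
  rw [List.length_dropLast] at this; omega

theorem tipTime_append (C : Chain Digest) (h : Header Digest) : tipTime (C ++ [h]) = h.time := by
  simp [tipTime]

theorem tipTime_nil : tipTime ([] : Chain Digest) = 0 := rfl

theorem time_le_tipTime {C : Chain Digest} (hC : C.Pairwise (fun a b => a.time < b.time))
    {h : Header Digest} (hh : h ∈ C) : h.time ≤ tipTime C := by
  rcases List.eq_nil_or_concat C with rfl | ⟨C', g, rfl⟩
  · simp at hh
  · rw [List.concat_eq_append] at *
    rw [tipTime_append]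
    rw [List.pairwise_append] at hC
    rcases List.mem_append.1 hh with h' | h'
    · exact (hC.2.2 h h' g (by simp)).le
    · simp at h'; rw [h']

/-- The only list of transactions that the header at the tip of `C` commits to. -/
def canon (p : Params Tx Digest) (C : Chain Digest) : List Tx :=
  match C.getLast? with
  | none => p.genesisTxs
  | some h => Function.invFun p.hash h.txsHash

/-- The ledger that the headers of `C` commit to. -/
def canonLedger (p : Params Tx Digest) (C : Chain Digest) : List Tx :=
  C.inits.flatMap (canon p)

/-- The content committed to at the tip of `C` is semantically valid. -/
def TipValid (p : Params Tx Digest) (C : Chain Digest) : Prop :=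
  SemValid p.valid (canonLedger p C.dropLast) (canon p C)

/-- Injectivity of the hash makes content a function of the header chain, so nodes can disagree on
what they have, but not on what a block contains. -/
theorem Commits.eq_canon {p : Params Tx Digest} (hp : Function.Injective p.hash)
    {C : Chain Digest} {txs : List Tx} (h : Commits p C txs) : txs = canon p C := by
  unfold Commits at h
  unfold canon
  cases hC : C.getLast? with
  | none => rw [hC] at h; simp at h
  | some g =>
    rw [hC] at h
    simp only [Option.map_some, Option.some.injEq] at h
    simp only [h]
    exact (Function.leftInverse_invFun hp txs).symm

theorem Commits.ne_nil {p : Params Tx Digest} {C : Chain Digest} {txs : List Tx}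
    (h : Commits p C txs) : C ≠ [] := by
  rintro rfl; simp [Commits] at h

theorem canonLedger_prefix (p : Params Tx Digest) {C D : Chain Digest} (h : C <+: D) :
    canonLedger p C <+: canonLedger p D := by
  obtain ⟨E, rfl⟩ := h
  unfold canonLedger
  rw [List.inits_append, List.flatMap_append]
  exact List.prefix_append _ _

theorem canonLedger_concat (p : Params Tx Digest) (C : Chain Digest) (h : Header Digest) :
    canonLedger p (C ++ [h]) = canonLedger p C ++ canon p (C ++ [h]) := by
  unfold canonLedger
  rw [List.inits_append]
  simp

end ChainLemmas

/-! ### Invariants of a single honest node -/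

/-- The properties of the state of an honest node that every event preserves. -/
structure NodeInv {Tx Digest : Type*} (p : Params Tx Digest) (n : NodeState Tx Digest) : Prop where
  prefix_closed : ∀ C ∈ n.headers, ∀ D, D <+: C → D ∈ n.headers
  nil_known : Downloaded n.blkTxs []
  known : ∀ C txs, n.blkTxs C = .known txs →
    C ∈ n.headers ∧ txs = canon p C ∧ (C ≠ [] → TipValid p C)
  known_prefix : ∀ C, Downloaded n.blkTxs C → ∀ D, D <+: C → Downloaded n.blkTxs D
  invalid : ∀ C, n.blkTxs C = .invalid → C ≠ [] ∧ ¬ TipValid p C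
  longest : IsLongest n.headers n.blkTxs n.longest

section NodeLemmas

variable {Tx Digest : Type*} {p : Params Tx Digest} {n : NodeState Tx Digest}

theorem NodeInv.initial (p : Params Tx Digest) : NodeInv p (initialNode p) := by
  have hk : ∀ C, Downloaded (initialNode p).blkTxs C → C = [] := by
    rintro C ⟨txs, h⟩
    by_contra hC
    simp [initialNode, hC] at h
  have hnil : Downloaded (initialNode p).blkTxs [] := ⟨p.genesisTxs, by simp [initialNode]⟩
  refine ⟨?_, hnil, ?_, ?_, ?_, ?_⟩
  · rintro C hC D hD
    have : C = [] := hC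
    subst this
    rw [List.prefix_nil] at hD
    exact hD
  · intro C txs h
    have : C = [] := hk C ⟨txs, h⟩
    subst this
    refine ⟨rfl, ?_, fun h => absurd rfl h⟩
    simp only [initialNode, if_true, Status.known.injEq] at h
    rw [← h]; rfl
  · intro C hC D hD
    rw [hk C hC, List.prefix_nil] at hD
    rwa [hD]
  · intro C h
    by_cases hC : C = [] <;> simp [initialNode, hC] at h
  · refine ⟨rfl, hnil, fun C hC _ => ?_⟩
    have : C = [] := hC
    rw [this]; rfl

/-- Removes the local state from ledgers: prefix relations between ledgers of different nodes reduce
to prefix relations between header chains. -/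
theorem NodeInv.ledger_eq (hn : NodeInv p n) {C : Chain Digest} (hC : Downloaded n.blkTxs C) :
    ledger n.blkTxs C = canonLedger p C := by
  unfold ledger canonLedger
  rw [List.flatMap_def, List.flatMap_def]
  congr 1
  apply List.map_congr_left
  intro D hD
  rw [List.mem_inits] at hD
  obtain ⟨txs, h⟩ := hn.known_prefix C hC D hD
  rw [h, ← (hn.known D txs h).2.1]
  rfl

theorem NodeInv.ledger_dropLast (hn : NodeInv p n) {C : Chain Digest} {txs : List Tx}
    (hC : CanProcess p n C txs) : ledger n.blkTxs C.dropLast = canonLedger p C.dropLast :=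
  hn.ledger_eq (hC.2.1 _ (List.dropLast_prefix C) (dropLast_ne_of_ne_nil hC.2.2.ne_nil))

open Classical in
theorem processed_of_ne (blk : Contents Tx Digest) {C D : Chain Digest} (txs : List Tx)
    (h : D ≠ C) : processed p blk C txs D = blk D := by
  simp [processed, Function.update_of_ne h]

open Classical in
theorem NodeInv.processed_self_valid (hp : Function.Injective p.hash) (hn : NodeInv p n)
    {C : Chain Digest} {txs : List Tx} (hC : CanProcess p n C txs) (hv : TipValid p C) :
    processed p n.blkTxs C txs C = .known txs := by
  unfold processed
  rw [Function.update_self, hn.ledger_dropLast hC, if_pos]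
  rw [hC.2.2.eq_canon hp]; exact hv

open Classical in
theorem NodeInv.processed_self_invalid (hp : Function.Injective p.hash) (hn : NodeInv p n)
    {C : Chain Digest} {txs : List Tx} (hC : CanProcess p n C txs) (hv : ¬ TipValid p C) :
    processed p n.blkTxs C txs C = .invalid := by
  unfold processed
  rw [Function.update_self, hn.ledger_dropLast hC, if_neg]
  rw [hC.2.2.eq_canon hp]; exact hv

/-- The adversary may push a content again. It must match the same header and was found valid
against the same canonical ledger, so nothing stored is lost. -/
theorem NodeInv.processed_of_known (hp : Function.Injective p.hash) (hn : NodeInv p n)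
    {C : Chain Digest} {txs : List Tx} (hC : CanProcess p n C txs) {D : Chain Digest}
    (hD : Downloaded n.blkTxs D) : processed p n.blkTxs C txs D = n.blkTxs D := by
  by_cases h : D = C
  · subst h
    obtain ⟨t, ht⟩ := hD
    obtain ⟨-, h1, h2⟩ := hn.known D t ht
    rw [hn.processed_self_valid hp hC (h2 hC.2.2.ne_nil), ht, h1, hC.2.2.eq_canon hp]
  · exact processed_of_ne _ _ h

theorem NodeInv.receiveContent (hp : Function.Injective p.hash) (hn : NodeInv p n)
    {C : Chain Digest} {txs : List Tx} (hC : CanProcess p n C txs) {D : Chain Digest}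
    (hD : IsLongest n.headers (processed p n.blkTxs C txs) D) (k : ℕ) :
    NodeInv p { n with blkTxs := processed p n.blkTxs C txs, longest := D, served := k } := by
  have hmono : ∀ E, Downloaded n.blkTxs E → Downloaded (processed p n.blkTxs C txs) E := by
    rintro E hE
    unfold Downloaded
    rw [hn.processed_of_known hp hC hE]; exact hE
  refine ⟨hn.prefix_closed, hmono _ hn.nil_known, ?_, ?_, ?_, hD⟩
  · intro E t hE
    dsimp only at hE
    by_cases h : E = C
    · subst h
      by_cases hv : TipValid p E
      · rw [hn.processed_self_valid hp hC hv] at hE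
        cases hE
        exact ⟨hC.1, hC.2.2.eq_canon hp, fun _ => hv⟩
      · rw [hn.processed_self_invalid hp hC hv] at hE
        cases hE
    · rw [processed_of_ne _ _ h] at hE
      exact hn.known E t hE
  · intro E hE F hF
    dsimp only at hE ⊢
    by_cases h : E = C
    · subst h
      by_cases hFE : F = E
      · rwa [hFE]
      · exact hmono _ (hC.2.1 F hF hFE)
    · obtain ⟨t, hE⟩ := hE
      rw [processed_of_ne _ _ h] at hE
      exact hmono _ (hn.known_prefix E ⟨t, hE⟩ F hF)
  · intro E hE
    dsimp only at hE
    by_cases h : E = C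
    · subst h
      by_cases hv : TipValid p E
      · rw [hn.processed_self_valid hp hC hv] at hE
        cases hE
      · exact ⟨hC.2.2.ne_nil, hv⟩
    · rw [processed_of_ne _ _ h] at hE
      exact hn.invalid E hE

theorem NodeInv.receiveHeader (hn : NodeInv p n) (C : Chain Digest) :
    NodeInv p { n with headers := n.headers ∪ {C' | C' <+: C} } := by
  refine ⟨?_, hn.nil_known, fun E t h => ⟨Or.inl (hn.known E t h).1, (hn.known E t h).2⟩,
    hn.known_prefix, hn.invalid, Or.inl hn.longest.1, hn.longest.2.1, ?_⟩
  · rintro E (hE | hE) D hD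
    · exact Or.inl (hn.prefix_closed E hE D hD)
    · exact Or.inr (hD.trans hE)
  · rintro E - ⟨t, hE⟩
    exact hn.longest.2.2 E (hn.known E t hE).1 ⟨t, hE⟩

theorem NodeInv.startSlot (hn : NodeInv p n) (k : ℕ) : NodeInv p { n with served := k } :=
  ⟨hn.prefix_closed, hn.nil_known, hn.known, hn.known_prefix, hn.invalid, hn.longest⟩

end NodeLemmas

/-! ### Invariants of the global state and monotonicity within a slot -/

/-- The properties of the global state that every event preserves. -/
structure StateInv {Tx Digest : Type*} (p : Params Tx Digest) (sys : System Tx)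
    (s : State Tx Digest) : Prop where
  nodes : ∀ P ∈ sys.honest, NodeInv p (s.node P)
  headers_sub : ∀ P ∈ sys.honest, (s.node P).headers ⊆ s.tree
  tree_prefix : ∀ C ∈ s.tree, ∀ D, D <+: C → D ∈ s.tree
  tree_sorted : ∀ C ∈ s.tree, C.Pairwise (fun a b => a.time < b.time)
  tree_leader : ∀ C ∈ s.tree, ∀ h ∈ C, 1 ≤ h.time ∧ h.time ≤ s.slot ∧ sys.leader h.node h.time ∧
    (h.node ∈ sys.honest ∨ h.node ∈ sys.corrupt)
  repo_known : ∀ P ∈ sys.honest, ∀ C, C ≠ [] → ∀ txs, (s.node P).blkTxs C = .known txs →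
    (C, txs) ∈ s.repo

/-- What can only grow when an event happens within a slot. -/
structure Later {Tx Digest : Type*} (sys : System Tx) (s s' : State Tx Digest) : Prop where
  slot : s'.slot = s.slot
  clock : s.clock ≤ s'.clock
  repo : s.repo ⊆ s'.repo
  sent : s.sent ⊆ s'.sent
  headers : ∀ P ∈ sys.honest, (s.node P).headers ⊆ (s'.node P).headers
  known : ∀ P ∈ sys.honest, ∀ C txs, (s.node P).blkTxs C = .known txs →
    (s'.node P).blkTxs C = .known txs

section StepLemmas

variable {Tx Digest : Type*} {p : Params Tx Digest} {sys : System Tx} {s s' : State Tx Digest}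

theorem Later.refl (sys : System Tx) (s : State Tx Digest) : Later sys s s :=
  ⟨rfl, le_rfl, subset_rfl, subset_rfl, fun _ _ => subset_rfl, fun _ _ _ _ h => h⟩

theorem Later.trans {s'' : State Tx Digest} (h : Later sys s s') (h' : Later sys s' s'') :
    Later sys s s'' :=
  ⟨h'.slot.trans h.slot, h.clock.trans h'.clock, h.repo.trans h'.repo, h.sent.trans h'.sent,
    fun P hP => (h.headers P hP).trans (h'.headers P hP),
    fun P hP C t hC => h'.known P hP C t (h.known P hP C t hC)⟩

theorem StateInv.initial (p : Params Tx Digest) (sys : System Tx) :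
    StateInv p sys (initialState p) := by
  refine ⟨fun _ _ => NodeInv.initial p, fun _ _ => subset_rfl, ?_, ?_, ?_, ?_⟩
  · rintro C hC D hD
    have : C = [] := hC
    subst this
    rw [List.prefix_nil] at hD
    exact hD
  · rintro C hC
    have : C = [] := hC
    subst this
    exact List.Pairwise.nil
  · rintro C hC h hh
    have : C = [] := hC
    subst this
    simp at hh
  · intro P _ C hC txs h
    simp [initialState, initialNode, hC] at h

theorem StateInv.later_receiveContent (hp : Function.Injective p.hash) (hs : StateInv p sys s)
    {P : ℕ} (hP : P ∈ sys.honest) {C : Chain Digest} {txs : List Tx} {D : Chain Digest} {k : ℕ}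
    (hC : CanProcess p (s.node P) C txs) : Later sys s (s.receiveContent p P C txs D k) := by
  refine ⟨rfl, le_rfl, Set.subset_union_left, subset_rfl, ?_, ?_⟩
  · intro Q _
    by_cases h : Q = P
    · subst h; simp [State.receiveContent]
    · simp [State.receiveContent, Function.update_of_ne h]
  · intro Q hQ E t hE
    by_cases h : Q = P
    · subst h
      simp only [State.receiveContent, Function.update_self]
      rw [(hs.nodes Q hQ).processed_of_known hp hC ⟨t, hE⟩, hE]
    · simpa [State.receiveContent, Function.update_of_ne h] using hE

theorem StateInv.receiveContent (hp : Function.Injective p.hash) (hs : StateInv p sys s)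
    {P : ℕ} (hP : P ∈ sys.honest) {C : Chain Digest} {txs : List Tx} {D : Chain Digest} {k : ℕ}
    (hC : CanProcess p (s.node P) C txs)
    (hD : IsLongest (s.node P).headers (processed p (s.node P).blkTxs C txs) D) :
    StateInv p sys (s.receiveContent p P C txs D k) := by
  refine ⟨?_, ?_, hs.tree_prefix, hs.tree_sorted, hs.tree_leader, ?_⟩
  · intro Q hQ
    by_cases h : Q = P
    · subst h
      simp only [State.receiveContent, Function.update_self]
      exact (hs.nodes Q hQ).receiveContent hp hC hD k
    · simpa [State.receiveContent, Function.update_of_ne h] using hs.nodes Q hQ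
  · intro Q hQ
    by_cases h : Q = P
    · subst h
      simpa only [State.receiveContent, Function.update_self] using hs.headers_sub Q hQ
    · simpa [State.receiveContent, Function.update_of_ne h] using hs.headers_sub Q hQ
  · intro Q hQ E hE t ht
    by_cases h : Q = P
    · subst h
      simp only [State.receiveContent, Function.update_self] at ht ⊢
      by_cases hEC : E = C
      · subst hEC
        right
        by_cases hv : TipValid p E
        · rw [(hs.nodes Q hQ).processed_self_valid hp hC hv] at ht
          cases ht
          refine ⟨rfl, ?_⟩
          rw [(hs.nodes Q hQ).ledger_dropLast hC, hC.2.2.eq_canon hp]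
          exact hv
        · rw [(hs.nodes Q hQ).processed_self_invalid hp hC hv] at ht
          cases ht
      · rw [processed_of_ne _ _ hEC] at ht
        exact Or.inl (hs.repo_known Q hQ E hE t ht)
    · simp only [State.receiveContent, Function.update_of_ne h] at ht
      exact Or.inl (hs.repo_known Q hQ E hE t ht)

theorem StateInv.step (hp : Function.Injective p.hash) (hs : StateInv p sys s)
    (h : Step p sys s s') : StateInv p sys s' ∧ Later sys s s' := by
  cases h with
  | tick y h1 h2 h3 =>
    exact ⟨⟨hs.nodes, hs.headers_sub, hs.tree_prefix, hs.tree_sorted, hs.tree_leader,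
      hs.repo_known⟩, ⟨rfl, h1, subset_rfl, subset_rfl, fun _ _ => subset_rfl,
      fun _ _ _ _ h => h⟩⟩
  | receiveHeader P C hP hC =>
    refine ⟨⟨?_, ?_, hs.tree_prefix, hs.tree_sorted, hs.tree_leader, ?_⟩,
      ⟨rfl, le_rfl, subset_rfl, Set.subset_insert _ _, ?_, ?_⟩⟩
    · intro Q hQ
      by_cases h : Q = P
      · subst h
        simpa only [State.receiveHeader, Function.update_self] using
          (hs.nodes Q hQ).receiveHeader C
      · simpa [State.receiveHeader, Function.update_of_ne h] using hs.nodes Q hQ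
    · intro Q hQ
      by_cases h : Q = P
      · subst h
        simp only [State.receiveHeader, Function.update_self]
        exact Set.union_subset (hs.headers_sub Q hQ) fun D hD => hs.tree_prefix C hC D hD
      · simpa [State.receiveHeader, Function.update_of_ne h] using hs.headers_sub Q hQ
    · intro Q hQ E hE t ht
      by_cases h : Q = P
      · subst h
        simp only [State.receiveHeader, Function.update_self] at ht
        exact hs.repo_known Q hQ E hE t ht
      · simp only [State.receiveHeader, Function.update_of_ne h] at ht
        exact hs.repo_known Q hQ E hE t ht
    · intro Q hQ
      by_cases h : Q = P
      · subst h
        simp only [State.receiveHeader, Function.update_self]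
        exact Set.subset_union_left
      · simp [State.receiveHeader, Function.update_of_ne h]
    · intro Q hQ E t ht
      by_cases h : Q = P
      · subst h
        simpa only [State.receiveHeader, Function.update_self] using ht
      · simpa [State.receiveHeader, Function.update_of_ne h] using ht
  | pushContent P C txs D hP hC hD =>
    exact ⟨hs.receiveContent hp hP hC hD, hs.later_receiveContent hp hP hC⟩
  | download P C txs D hP h1 h2 h3 h4 hC hD =>
    exact ⟨hs.receiveContent hp hP hC hD, hs.later_receiveContent hp hP hC⟩
  | produce P t C txs hP hl hC ht hts =>
    refine ⟨⟨hs.nodes, fun Q hQ => (hs.headers_sub Q hQ).trans (Set.subset_insert _ _), ?_, ?_, ?_,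
      hs.repo_known⟩, ⟨rfl, le_rfl, subset_rfl, subset_rfl, fun _ _ => subset_rfl,
      fun _ _ _ _ h => h⟩⟩
    · rintro E (rfl | hE) D hD
      · rw [List.prefix_concat_iff] at hD
        rcases hD with rfl | hD
        · exact Or.inl rfl
        · exact Or.inr (hs.tree_prefix C hC D hD)
      · exact Or.inr (hs.tree_prefix E hE D hD)
    · rintro E (rfl | hE)
      · rw [List.pairwise_append]
        refine ⟨hs.tree_sorted C hC, List.pairwise_singleton _ _, ?_⟩
        intro a ha b hb
        simp only [List.mem_singleton] at hb
        subst hb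
        exact (time_le_tipTime (hs.tree_sorted C hC) ha).trans_lt ht
      · exact hs.tree_sorted E hE
    · rintro E (rfl | hE) g hg
      · rcases List.mem_append.1 hg with hg | hg
        · exact hs.tree_leader C hC g hg
        · simp only [List.mem_singleton] at hg
          subst hg
          exact ⟨by dsimp only; omega, hts, hl, Or.inr hP⟩
      · exact hs.tree_leader E hE g hg
  | upload C txs hC =>
    exact ⟨⟨hs.nodes, hs.headers_sub, hs.tree_prefix, hs.tree_sorted, hs.tree_leader,
      fun P hP E hE t ht => Or.inr (hs.repo_known P hP E hE t ht)⟩, ⟨rfl, le_rfl,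
      Set.subset_insert _ _, subset_rfl, fun _ _ => subset_rfl, fun _ _ _ _ h => h⟩⟩

theorem StateInv.steps (hp : Function.Injective p.hash) (hs : StateInv p sys s)
    (h : Relation.ReflTransGen (Step p sys) s s') : StateInv p sys s' ∧ Later sys s s' := by
  induction h with
  | refl => exact ⟨hs, Later.refl sys s⟩
  | tail _ h ih =>
    obtain ⟨h1, h2⟩ := ih
    obtain ⟨h3, h4⟩ := h1.step hp h
    exact ⟨h3, h2.trans h4⟩

theorem StateInv.startSlot (hs : StateInv p sys s) (txs : ℕ → List Tx) :
    StateInv p sys (s.startSlot p sys txs) := by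
  refine ⟨fun P hP => (hs.nodes P hP).startSlot 0,
    fun P hP => (hs.headers_sub P hP).trans Set.subset_union_left, ?_, ?_, ?_,
    fun P hP E hE t ht => Or.inl (hs.repo_known P hP E hE t ht)⟩
  · rintro E (hE | ⟨P, hP, hl, rfl⟩) D hD
    · exact Or.inl (hs.tree_prefix E hE D hD)
    · have hD' := hD
      unfold proposal at hD
      rw [List.prefix_concat_iff] at hD
      rcases hD with rfl | hD
      · exact Or.inr ⟨P, hP, hl, rfl⟩
      · exact Or.inl (hs.tree_prefix _ (hs.headers_sub P hP (hs.nodes P hP).longest.1) D hD)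
  · rintro E (hE | ⟨P, hP, hl, rfl⟩)
    · exact hs.tree_sorted E hE
    · have hm := hs.headers_sub P hP (hs.nodes P hP).longest.1
      unfold proposal
      rw [List.pairwise_append]
      refine ⟨hs.tree_sorted _ hm, List.pairwise_singleton _ _, ?_⟩
      intro a ha b hb
      simp only [List.mem_singleton] at hb
      subst hb
      exact Nat.lt_succ_of_le (hs.tree_leader _ hm a ha).2.1
  · rintro E (hE | ⟨P, hP, hl, rfl⟩) g hg
    · obtain ⟨h1, h2, h3⟩ := hs.tree_leader E hE g hg
      exact ⟨h1, h2.trans (Nat.le_succ _), h3⟩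
    · have hm := hs.headers_sub P hP (hs.nodes P hP).longest.1
      rcases List.mem_append.1 hg with hg | hg
      · obtain ⟨h1, h2, h3⟩ := hs.tree_leader _ hm g hg
        exact ⟨h1, h2.trans (Nat.le_succ _), h3⟩
      · simp only [List.mem_singleton] at hg
        subst hg
        exact ⟨Nat.succ_pos _, le_rfl, hl, Or.inl hP⟩

end StepLemmas

/-! ### Slots with a unique honest leader and the download of their proposals -/

/-- Node `P` is the only eligible node of slot `u`, and it is honest. -/
structure UniqueLeader {Tx : Type*} (sys : System Tx) (P u : ℕ) : Prop where
  pos : 1 ≤ u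
  honest : P ∈ sys.honest
  leader : sys.leader P u
  honest_eq : ∀ Q ∈ sys.honest, sys.leader Q u → Q = P
  corrupt_not : ∀ Q ∈ sys.corrupt, ¬ sys.leader Q u

/-- The header chain that the honest leader `P` of slot `u` proposes. -/
def Run.block {Tx Digest : Type*} {p : Params Tx Digest} {sys : System Tx} {T : ℕ}
    (R : Run p sys T) (P u : ℕ) : Chain Digest :=
  proposal p (R.state (u - 1)) P (R.txs u P)

/-- Every header of an honest node comes from a proposal. -/
def Run.HonestOrigin {Tx Digest : Type*} {p : Params Tx Digest} {sys : System Tx} {T : ℕ}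
    (R : Run p sys T) (s : State Tx Digest) : Prop :=
  ∀ C h, C ++ [h] ∈ s.tree → h.node ∈ sys.honest → C ++ [h] = R.block h.node h.time

/-- The number of blocks of `B` that are not downloaded. -/
def missing {Tx Digest : Type*} (blk : Contents Tx Digest) (B : Chain Digest) : ℕ :=
  {k | k ≤ B.length ∧ ¬ Downloaded blk (B.take k)}.ncard

section RunLemmas

variable {Tx Digest : Type*} {p : Params Tx Digest} {sys : System Tx} {T : ℕ}
  {s s' : State Tx Digest}

theorem missing_finite (blk : Contents Tx Digest) (B : Chain Digest) :
    {k | k ≤ B.length ∧ ¬ Downloaded blk (B.take k)}.Finite :=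
  (Set.finite_Iic B.length).subset fun _ hk => hk.1

theorem missing_mono {blk blk' : Contents Tx Digest}
    (h : ∀ C txs, blk C = .known txs → blk' C = .known txs) (B : Chain Digest) :
    missing blk' B ≤ missing blk B := by
  refine Set.ncard_le_ncard ?_ (missing_finite blk B)
  rintro k ⟨hk, hk'⟩
  exact ⟨hk, fun ⟨t, ht⟩ => hk' ⟨t, h _ _ ht⟩⟩

theorem missing_lt {blk blk' : Contents Tx Digest}
    (h : ∀ C txs, blk C = .known txs → blk' C = .known txs) {B C : Chain Digest}
    (hC : C <+: B) (h1 : ¬ Downloaded blk C) (h2 : Downloaded blk' C) :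
    missing blk' B + 1 ≤ missing blk B := by
  refine Set.ncard_lt_ncard ?_ (missing_finite blk B)
  rw [Set.ssubset_iff_of_subset]
  · have : B.take C.length = C := (List.prefix_iff_eq_take.1 hC).symm
    exact ⟨C.length, ⟨hC.length_le, by rwa [this]⟩, fun h => h.2 (by rwa [this])⟩
  · rintro k ⟨hk, hk'⟩
    exact ⟨hk, fun ⟨t, ht⟩ => hk' ⟨t, h _ _ ht⟩⟩

/-- Downloaded blocks are closed under prefixes, so only the blocks beyond `C` can be missing. -/
theorem NodeInv.missing_le {n : NodeState Tx Digest} (hn : NodeInv p n) {B C : Chain Digest}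
    (hC : C <+: B) (h : Downloaded n.blkTxs C) : missing n.blkTxs B ≤ B.length - C.length := by
  have : {k | k ≤ B.length ∧ ¬ Downloaded n.blkTxs (B.take k)} ⊆
      (Finset.Ioc C.length B.length : Finset ℕ) := by
    rintro k ⟨hk, hk'⟩
    simp only [Finset.coe_Ioc, Set.mem_Ioc]
    refine ⟨?_, hk⟩
    by_contra hlt
    apply hk'
    refine hn.known_prefix C h _ ?_
    rw [List.prefix_iff_eq_take.1 hC]
    exact (List.take_prefix_take_left (by omega))
  calc missing n.blkTxs B ≤ ((Finset.Ioc C.length B.length : Finset ℕ) : Set ℕ).ncard :=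
        Set.ncard_le_ncard this (Finset.finite_toSet _)
    _ = _ := by rw [Set.ncard_coe_finset, Nat.card_Ioc]

theorem downloaded_of_missing_eq_zero {blk : Contents Tx Digest} {B : Chain Digest}
    (h : missing blk B = 0) : Downloaded blk B := by
  unfold missing at h
  rw [Set.ncard_eq_zero (missing_finite blk B)] at h
  by_contra hB
  have : B.length ∈ {k | k ≤ B.length ∧ ¬ Downloaded blk (B.take k)} :=
    ⟨le_rfl, by rwa [List.take_length]⟩
  rw [h] at this
  exact this

theorem StateInv.tipTime_le (hs : StateInv p sys s) {C : Chain Digest} (hC : C ∈ s.tree) :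
    tipTime C ≤ s.slot := by
  rcases List.eq_nil_or_concat C with rfl | ⟨C', g, rfl⟩
  · exact Nat.zero_le _
  · rw [List.concat_eq_append] at *
    rw [tipTime_append]
    exact (hs.tree_leader _ hC g (by simp)).2.1

theorem Step.tree_subset (h : Step p sys s s') :
    ∀ D ∈ s'.tree, D ∈ s.tree ∨ ∃ C h, D = C ++ [h] ∧ h.node ∈ sys.corrupt := by
  intro D hD
  cases h with
  | produce P t C txs hP hl hC ht hts =>
    rcases hD with rfl | hD
    · exact Or.inr ⟨_, _, rfl, hP⟩
    · exact Or.inl hD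
  | _ => exact Or.inl hD

/-- Within a slot only corrupt nodes create headers, under their own identity; disjointness from the
honest nodes plays the role of unforgeability. -/
theorem Run.HonestOrigin.step {R : Run p sys T} (hdis : Disjoint sys.honest sys.corrupt)
    (ho : R.HonestOrigin s) (h : Step p sys s s') : R.HonestOrigin s' := by
  intro C g hg hh
  rcases h.tree_subset _ hg with h1 | ⟨C', g', h1, h2⟩
  · exact ho C g h1 hh
  · obtain ⟨-, h3⟩ := List.append_inj' h1 rfl
    simp only [List.cons.injEq, and_true] at h3
    subst h3
    exact absurd h2 (Finset.disjoint_left.1 hdis hh)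

theorem Run.HonestOrigin.startSlot {R : Run p sys T} {t : ℕ} (hslot : (R.state t).slot = t)
    (ho : R.HonestOrigin (R.state t)) :
    R.HonestOrigin ((R.state t).startSlot p sys (R.txs (t + 1))) := by
  rintro C g (hg | ⟨P, hP, hl, h1⟩) hh
  · exact ho C g hg hh
  · rw [h1]
    unfold proposal at h1
    obtain ⟨-, h3⟩ := List.append_inj' h1 rfl
    simp only [List.cons.injEq, and_true] at h3
    subst h3
    simp only [Run.block, hslot, Nat.add_sub_cancel]

theorem Run.invariants (R : Run p sys T) (hp : Function.Injective p.hash)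
    (hdis : Disjoint sys.honest sys.corrupt) :
    ∀ t ≤ T, StateInv p sys (R.state t) ∧ R.HonestOrigin (R.state t) ∧ (R.state t).slot = t ∧
      (R.state t).clock = t * p.slot := by
  intro t
  induction t with
  | zero =>
    intro _
    rw [R.init]
    refine ⟨StateInv.initial p sys, ?_, rfl, by simp [initialState]⟩
    intro C h hC
    simp [initialState] at hC
  | succ t ih =>
    intro ht
    obtain ⟨h1, h2, h3, -⟩ := ih (by omega)
    have hsteps := R.steps t (by omega)
    have hL := (h1.startSlot (R.txs (t + 1))).steps hp hsteps
    have hslot : (R.state (t + 1)).slot = t + 1 := by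
      rw [hL.2.slot]; simp [State.startSlot, h3]
    refine ⟨hL.1, ?_, hslot, ?_⟩
    · have : ∀ s', Relation.ReflTransGen (Step p sys)
          ((R.state t).startSlot p sys (R.txs (t + 1))) s' → R.HonestOrigin s' := by
        intro s' hs'
        induction hs' with
        | refl => exact h2.startSlot h3
        | tail _ h ih => exact ih.step hdis h
      exact this _ hsteps
    · rw [(R.ends t (by omega)).1, hslot]

theorem Run.later (R : Run p sys T) (hp : Function.Injective p.hash)
    (hdis : Disjoint sys.honest sys.corrupt) {t : ℕ} (ht : t < T) :
    Later sys ((R.state t).startSlot p sys (R.txs (t + 1))) (R.state (t + 1)) :=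
  (((R.invariants hp hdis t ht.le).1.startSlot _).steps hp (R.steps t ht)).2

theorem Run.known_mono (R : Run p sys T) (hp : Function.Injective p.hash)
    (hdis : Disjoint sys.honest sys.corrupt) {i : ℕ} (hi : i ∈ sys.honest) {C : Chain Digest}
    {t t' : ℕ} (htt : t ≤ t') (ht : t' ≤ T)
    (hC : Downloaded ((R.state t).node i).blkTxs C) :
    Downloaded ((R.state t').node i).blkTxs C := by
  induction t', htt using Nat.le_induction with
  | base => exact hC
  | succ n hn ih =>
    obtain ⟨l, hl⟩ := ih (by omega)
    exact ⟨l, (R.later hp hdis (by omega)).known i hi C l hl⟩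

theorem Run.length_le (R : Run p sys T) (hp : Function.Injective p.hash)
    (hdis : Disjoint sys.honest sys.corrupt) {i : ℕ} (hi : i ∈ sys.honest) {C : Chain Digest}
    {t : ℕ} (ht : t ≤ T) (hC : Downloaded ((R.state t).node i).blkTxs C) :
    C.length ≤ ((R.state t).node i).longest.length := by
  have h := (R.invariants hp hdis t ht).1.nodes i hi
  obtain ⟨l, hl⟩ := hC
  exact h.longest.2.2 C (h.known C l hl).1 ⟨l, hl⟩

theorem Run.length_mono (R : Run p sys T) (hp : Function.Injective p.hash)
    (hdis : Disjoint sys.honest sys.corrupt) {i : ℕ} (hi : i ∈ sys.honest)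
    {t t' : ℕ} (htt : t ≤ t') (ht : t' ≤ T) :
    ((R.state t).node i).longest.length ≤ ((R.state t').node i).longest.length :=
  R.length_le hp hdis hi ht (R.known_mono hp hdis hi htt ht
    ((R.invariants hp hdis t (htt.trans ht)).1.nodes i hi).longest.2.1)

theorem Run.block_succ (R : Run p sys T) (hp : Function.Injective p.hash)
    (hdis : Disjoint sys.honest sys.corrupt) {t : ℕ} (ht : t ≤ T) (P : ℕ) :
    R.block P (t + 1) =
      ((R.state t).node P).longest ++ [⟨t + 1, P, p.hash (R.txs (t + 1) P)⟩] := by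
  simp only [Run.block, proposal, Nat.add_sub_cancel, (R.invariants hp hdis t ht).2.2.1]

/-- Corrupt nodes are not eligible in slot `u`, so no equivocation or backdating is possible there:
one slot number identifies one whole chain. -/
theorem eq_block_of_tipTime {R : Run p sys T} (hs : StateInv p sys s) (ho : R.HonestOrigin s)
    {P u : ℕ} (hu : UniqueLeader sys P u) {C : Chain Digest} (hC : C ∈ s.tree)
    (ht : tipTime C = u) : C = R.block P u := by
  have hpos := hu.pos
  rcases List.eq_nil_or_concat C with rfl | ⟨C', g, rfl⟩
  · rw [tipTime_nil] at ht; omega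
  · rw [List.concat_eq_append] at *
    rw [tipTime_append] at ht
    subst ht
    obtain ⟨-, -, hl, hg⟩ := hs.tree_leader _ hC g (by simp)
    have hh : g.node ∈ sys.honest := by
      rcases hg with hg | hg
      · exact hg
      · exact absurd hl (hu.corrupt_not _ hg)
    rw [ho C' g hC hh, hu.honest_eq _ hh hl]

/-- Every block of the proposal of an honest leader is semantically valid. -/
theorem Run.block_valid (R : Run p sys T) (hp : Function.Injective p.hash)
    (hdis : Disjoint sys.honest sys.corrupt) {t : ℕ} (ht : t < T) {P : ℕ} (hP : P ∈ sys.honest)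
    (hl : sys.leader P (t + 1)) {C : Chain Digest} (hC : C <+: R.block P (t + 1)) (hne : C ≠ []) :
    TipValid p C := by
  obtain ⟨h1, -, -, -⟩ := R.invariants hp hdis t ht.le
  have hn := h1.nodes P hP
  have hb := R.block_succ hp hdis ht.le P
  rw [hb, List.prefix_concat_iff] at hC
  rcases hC with rfl | hC
  · have hpc := (R.proposals t ht P hP hl).2.1
    unfold TipValid
    have hcan : R.txs (t + 1) P = canon p (((R.state t).node P).longest ++
        [⟨t + 1, P, p.hash (R.txs (t + 1) P)⟩]) := by
      apply Commits.eq_canon hp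
      simp [Commits]
    rw [← hcan, List.dropLast_concat, ← hn.ledger_eq hn.longest.2.1]
    exact hpc
  · obtain ⟨l, h⟩ := hn.known_prefix _ hn.longest.2.1 C hC
    exact (hn.known C l h).2.2 hne

theorem Run.canon_block (R : Run p sys T) (hp : Function.Injective p.hash) (P u : ℕ) :
    canon p (R.block P u) = R.txs u P := by
  symm
  apply Commits.eq_canon hp
  simp [Commits, Run.block, proposal]

variable {i P t : ℕ}

/-- No tip can be newer than the current slot, and the valid proposal is never marked invalid. The
freshest candidate thus has its slot, which determines the chain. -/
theorem Run.freshest_eq {R : Run p sys T} (hp : Function.Injective p.hash)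
    (hdis : Disjoint sys.honest sys.corrupt) (ht : t < T) (hu : UniqueLeader sys P (t + 1))
    (hi : i ∈ sys.honest) (hs : StateInv p sys s) (ho : R.HonestOrigin s) (hslot : s.slot = t + 1)
    (hB : R.block P (t + 1) ∈ (s.node i).headers) {C : Chain Digest}
    (hC : IsFreshest (s.node i).headers (s.node i).blkTxs C) : C = R.block P (t + 1) := by
  have hcand : R.block P (t + 1) ∈ candidates (s.node i).headers (s.node i).blkTxs := by
    refine ⟨hB, fun D hD hinv => ?_⟩
    obtain ⟨h1, h2⟩ := (hs.nodes i hi).invalid D hinv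
    exact h2 (R.block_valid hp hdis ht hu.honest hu.leader hD h1)
  have h1 := hC.2 _ hcand
  rw [R.block_succ hp hdis ht.le P, tipTime_append] at h1
  have hm := hs.headers_sub i hi hC.1.1
  have h2 := hs.tipTime_le hm
  exact eq_block_of_tipTime hs ho hu hm (by dsimp only at h1; omega)

/-- Bandwidth accounting: each served request removes a missing block of the proposal, as downloads
start only once the header has arrived. Pushed content can only lower the sum. -/
theorem Run.served_step {R : Run p sys T} (hp : Function.Injective p.hash)
    (hdis : Disjoint sys.honest sys.corrupt) (hrule : p.rule = freshestBlockRule Tx Digest)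
    (ht : t < T) (hu : UniqueLeader sys P (t + 1))
    (hi : i ∈ sys.honest) (hs : StateInv p sys s) (ho : R.HonestOrigin s) (hslot : s.slot = t + 1)
    (hB : t * p.slot + p.headerDelay < s.clock → R.block P (t + 1) ∈ (s.node i).headers)
    (h : Step p sys s s') :
    (s'.node i).served + missing (s'.node i).blkTxs (R.block P (t + 1)) ≤
      (s.node i).served + missing (s.node i).blkTxs (R.block P (t + 1)) := by
  have hL := (hs.step hp h).2
  cases h with
  | receiveHeader Q C hQ hC =>
    by_cases hQi : i = Q
    · subst hQi; simp [State.receiveHeader]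
    · simp [State.receiveHeader, Function.update_of_ne hQi]
  | pushContent Q C txs D hQ hC hD =>
    have := missing_mono (hL.known i hi) (R.block P (t + 1))
    by_cases hQi : i = Q
    · subst hQi
      have h2 : ((s.receiveContent p i C txs D (s.node i).served).node i).served =
        (s.node i).served := by simp [State.receiveContent]
      omega
    · simp [State.receiveContent, Function.update_of_ne hQi]
  | download Q C txs D hQ h1 h2 h3 h4 hC hD =>
    by_cases hQi : i = Q
    · subst hQi
      rw [hslot] at h1
      push_cast at h1
      rw [add_sub_cancel_right] at h1
      rw [hrule] at h2
      obtain ⟨E, hE, hEC⟩ := h2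
      have hEB := Run.freshest_eq hp hdis ht hu hi hs ho hslot (hB h1) hE
      subst hEB
      obtain ⟨h5, h6, -⟩ := hEC
      have hval := R.block_valid hp hdis ht hu.honest hu.leader h5 hC.2.2.ne_nil
      have h7 : Downloaded ((s.receiveContent p i C txs D ((s.node i).served + 1)).node i).blkTxs
          C := by
        simp only [State.receiveContent, Function.update_self]
        exact ⟨txs, (hs.nodes i hi).processed_self_valid hp hC hval⟩
      have := missing_lt (hL.known i hi) h5 (by rintro ⟨l, hl⟩; rw [h6] at hl; cases hl) h7
      have h8 : ((s.receiveContent p i C txs D ((s.node i).served + 1)).node i).served =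
        (s.node i).served + 1 := by simp [State.receiveContent]
      omega
    · simp [State.receiveContent, Function.update_of_ne hQi]
  | _ => exact le_rfl

/-- Only `tick` advances the clock, and its guard forces delivery before the deadline is passed;
header trees never shrink. -/
theorem Step.header_arrived (hs : StateInv p sys s) (hp : Function.Injective p.hash)
    (h : Step p sys s s') {C : Chain Digest} {x : ℝ} (hC : (C, x) ∈ s.sent) (hi : i ∈ sys.honest)
    (hold : x + p.headerDelay < s.clock → C ∈ (s.node i).headers) :
    x + p.headerDelay < s'.clock → C ∈ (s'.node i).headers := by
  intro hx
  have hL := (hs.step hp h).2.headers i hi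
  cases h with
  | tick y h1 h2 h3 => exact h3 C x hC hx i hi
  | _ => exact hL (hold hx)

/-- In a slot with a unique honest leader, every honest node that misses at most `slotCapacity`
blocks of the proposed chain downloads that chain. -/
theorem Run.downloaded_block (R : Run p sys T) (hp : Function.Injective p.hash)
    (hdis : Disjoint sys.honest sys.corrupt) (hrule : p.rule = freshestBlockRule Tx Digest)
    (hdelay : 0 ≤ p.headerDelay) (hbw : 0 < p.bandwidth) (hK : 0 < p.slotCapacity)
    (ht : t < T) (hu : UniqueLeader sys P (t + 1)) (hi : i ∈ sys.honest)
    (hmiss : missing ((R.state t).node i).blkTxs (R.block P (t + 1)) ≤ p.slotCapacity) :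
    Downloaded ((R.state (t + 1)).node i).blkTxs (R.block P (t + 1)) := by
  obtain ⟨i1, i2, i3, i4⟩ := R.invariants hp hdis t ht.le
  obtain ⟨j1, j2, j3, j4⟩ := R.invariants hp hdis (t + 1) ht
  have hsent : (R.block P (t + 1), (t : ℝ) * p.slot) ∈
      ((R.state t).startSlot p sys (R.txs (t + 1))).sent := by
    right
    exact ⟨P, hu.honest, by rw [i3]; exact hu.leader,
      by rw [← i4, R.block_succ hp hdis ht.le, proposal, i3]⟩
  have key : ∀ s, Relation.ReflTransGen (Step p sys)
      ((R.state t).startSlot p sys (R.txs (t + 1))) s →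
      StateInv p sys s ∧ R.HonestOrigin s ∧
      Later sys ((R.state t).startSlot p sys (R.txs (t + 1))) s ∧
      (t * p.slot + p.headerDelay < s.clock → R.block P (t + 1) ∈ (s.node i).headers) ∧
      (s.node i).served + missing (s.node i).blkTxs (R.block P (t + 1)) ≤
        missing ((R.state t).node i).blkTxs (R.block P (t + 1)) := by
    intro s hs
    induction hs with
    | refl =>
      refine ⟨i1.startSlot _, i2.startSlot i3, Later.refl _ _, ?_, ?_⟩
      -- The clock still reads `t * p.slot`, so with a nonnegative delay the premise fails.
      · intro h
        simp only [State.startSlot, i4] at h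
        linarith
      · simp [State.startSlot]
    | tail _ h ih =>
      obtain ⟨k1, k2, k3, k4, k5⟩ := ih
      obtain ⟨l1, l2⟩ := k1.step hp h
      have hslot := k3.slot
      simp only [State.startSlot, i3] at hslot
      exact ⟨l1, k2.step hdis h, k3.trans l2, h.header_arrived k1 hp (k3.sent hsent) hi k4,
        (Run.served_step hp hdis hrule ht hu hi k1 k2 hslot k4 h).trans k5⟩
  obtain ⟨k1, k2, k3, k4, k5⟩ := key _ (R.steps t ht)
  -- A positive capacity makes the slot strictly longer than the header delay, so the header has
  -- arrived by its end.
  have hB := k4 (by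
    rw [j4]
    push_cast
    have : p.slot = p.headerDelay + p.slotCapacity / p.bandwidth := rfl
    have : 0 < (p.slotCapacity : ℝ) / p.bandwidth := by positivity
    linarith)
  -- If the full capacity was served, the accounting bound leaves no missing block.
  rcases (R.ends t ht).2 i hi with h | ⟨r, hr, hr'⟩
  · apply downloaded_of_missing_eq_zero
    omega
  · rw [hrule] at hr
    obtain ⟨E, hE, hEr⟩ := hr
    have hEB := Run.freshest_eq hp hdis ht hu hi k1 k2 j3 hB hE
    subst hEB
    cases r with
    | none =>
      have h1 := hEr _ List.prefix_rfl
      have h2 := hE.1.2 _ List.prefix_rfl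
      cases h3 : ((R.state (t + 1)).node i).blkTxs (R.block P (t + 1)) with
      | unknown => exact absurd h3 h1
      | invalid => exact absurd h3 h2
      | known l => exact ⟨l, h3⟩
    | some D =>
      -- A requested block is never unavailable: the leader uploaded its own content, and it had
      -- downloaded all earlier ones, which puts them in the repository.
      exfalso
      obtain ⟨h1, h2, -⟩ := hEr
      have hD0 : D ≠ [] := by
        rintro rfl
        obtain ⟨l, hl⟩ := (k1.nodes i hi).nil_known
        rw [h2] at hl
        cases hl
      have hb := R.block_succ hp hdis ht.le P
      by_cases hDB : D = R.block P (t + 1)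
      · refine hr' D (R.txs (t + 1) P) rfl (k3.repo (Or.inr ⟨P, hu.honest, ?_, ?_⟩))
        · rw [i3]; exact hu.leader
        · rw [hDB, hb, proposal, i3]
      · have h3 := prefix_dropLast_of_ne h1 hDB
        rw [hb, List.dropLast_concat] at h3
        have hn := i1.nodes P hu.honest
        obtain ⟨l, hl⟩ := hn.known_prefix _ hn.longest.2.1 D h3
        exact hr' D l rfl (k3.repo (Or.inl (i1.repo_known P hu.honest D hD0 l hl)))

end RunLemmas

/-! ### Pivots and the persistence of their blocks -/

/-- Every interval of indices in `[0, T)` that contains the index `u - 1` has a positive sum. -/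
structure IsPivot (x : ℕ → ℤ) (T u : ℕ) : Prop where
  pos : 1 ≤ u
  lt : ∀ r s, r < u → u ≤ s → s ≤ T → ∑ k ∈ Finset.range r, x k < ∑ k ∈ Finset.range s, x k

/-- Some node is eligible in slot `u`. -/
def HasLeader {Tx : Type*} (sys : System Tx) (u : ℕ) : Prop :=
  ∃ Q, (Q ∈ sys.honest ∨ Q ∈ sys.corrupt) ∧ sys.leader Q u

open Classical in
/-- The contribution of slot `k + 1`: `1` if it has a unique leader, which is honest, `0` if it has
no leader, `-1` otherwise. -/
def slotStep {Tx : Type*} (sys : System Tx) (k : ℕ) : ℤ :=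
  if ∃ P, UniqueLeader sys P (k + 1) then 1 else if HasLeader sys (k + 1) then -1 else 0

/-- Up to slot `n`, the proposals of unique leaders are downloaded by all honest nodes by the end of
the slot. -/
def Run.Prompt {Tx Digest : Type*} {p : Params Tx Digest} {sys : System Tx} {T : ℕ}
    (R : Run p sys T) (n : ℕ) : Prop :=
  ∀ P u, UniqueLeader sys P u → u ≤ n → ∀ i ∈ sys.honest,
    Downloaded ((R.state u).node i).blkTxs (R.block P u)

section PivotLemmas

variable {Tx Digest : Type*} {p : Params Tx Digest} {sys : System Tx} {T : ℕ}

theorem UniqueLeader.eq {P Q u : ℕ} (h : UniqueLeader sys P u) (h' : UniqueLeader sys Q u) :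
    Q = P :=
  h.honest_eq Q h'.honest h'.leader

theorem IsPivot.uniqueLeader {u : ℕ} (h : IsPivot (slotStep sys) T u) (hu : u ≤ T) :
    ∃ P, UniqueLeader sys P u := by
  obtain ⟨k, rfl⟩ : ∃ k, u = k + 1 := ⟨u - 1, by have := h.pos; omega⟩
  -- The one-slot interval: the step of the pivot itself is positive.
  have h1 := h.lt k (k + 1) (by omega) le_rfl hu
  rw [Finset.sum_range_succ] at h1
  by_contra hne
  have : slotStep sys k ≤ 0 := by
    unfold slotStep
    rw [if_neg hne]
    split_ifs <;> norm_num
  omega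

open Classical in
theorem sum_slotStep {r s : ℕ} (h : r ≤ s) :
    ∑ k ∈ Finset.range s, slotStep sys k - ∑ k ∈ Finset.range r, slotStep sys k =
      (({k ∈ Finset.Ico r s | ∃ P, UniqueLeader sys P (k + 1)}.card : ℕ) : ℤ) -
      ({k ∈ Finset.Ico r s | HasLeader sys (k + 1) ∧
        ¬ ∃ P, UniqueLeader sys P (k + 1)}.card : ℕ) := by
  rw [← Finset.sum_Ico_eq_sub _ h, Finset.card_filter, Finset.card_filter]
  push_cast
  rw [← Finset.sum_sub_distrib]
  apply Finset.sum_congr rfl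
  intro k _
  unfold slotStep
  by_cases h1 : ∃ P, UniqueLeader sys P (k + 1)
  · simp [h1]
  · by_cases h2 : HasLeader sys (k + 1) <;> simp [h1, h2]

theorem Run.length_block (R : Run p sys T) (hp : Function.Injective p.hash)
    (hdis : Disjoint sys.honest sys.corrupt) {n t P i : ℕ} (hn : n ≤ T) (hR : R.Prompt n)
    (ht : t < n) (hu : UniqueLeader sys P (t + 1)) (hi : i ∈ sys.honest) :
    ((R.state t).node P).longest.length + 1 ≤ ((R.state (t + 1)).node i).longest.length := by
  have h := R.length_le hp hdis hi (by omega) (hR P (t + 1) hu (by omega) i hi)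
  rw [R.block_succ hp hdis (by omega), List.length_append] at h
  simpa using h

open Classical in
/-- Chain growth: every slot with a unique honest leader lengthens the longest chains. -/
theorem Run.growth (R : Run p sys T) (hp : Function.Injective p.hash)
    (hdis : Disjoint sys.honest sys.corrupt) {n r m l : ℕ} (hn : n ≤ T) (hR : R.Prompt n)
    (hrm : r ≤ m) (hm : m ≤ n)
    (hr : ∀ i ∈ sys.honest, l ≤ ((R.state r).node i).longest.length) :
    ∀ i ∈ sys.honest, l + {k ∈ Finset.Ico r m | ∃ P, UniqueLeader sys P (k + 1)}.card ≤
      ((R.state m).node i).longest.length := by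
  induction m, hrm using Nat.le_induction with
  | base => simpa using hr
  | succ m hrm ih =>
    intro i hi
    rw [← Finset.insert_Ico_right_eq_Ico_add_one hrm, Finset.filter_insert]
    split_ifs with h
    · obtain ⟨P, hP⟩ := h
      have h1 := ih (by omega) P hP.honest
      have h2 := R.length_block hp hdis hn hR (by omega) hP hi
      rw [Finset.card_insert_of_notMem (by simp)]
      omega
    · exact (ih (by omega) i hi).trans (R.length_mono hp hdis hi (by omega) (by omega))

open Classical in
/-- A chain extension without blocks of unique leaders is not longer than the number of slots that
have a leader but no unique honest one. -/
theorem StateInv.length_le_of_no_unique {s : State Tx Digest}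
    (hs : StateInv p sys s) {E F : Chain Digest} {m : ℕ} (hslot : s.slot = m)
    (hEF : E ++ F ∈ s.tree)
    (hno : ∀ C, C <+: E ++ F → ∀ P, tipTime E < tipTime C → ¬ UniqueLeader sys P (tipTime C)) :
    F.length ≤ {k ∈ Finset.Ico (tipTime E) m | HasLeader sys (k + 1) ∧
        ¬ ∃ P, UniqueLeader sys P (k + 1)}.card := by
  have hsort := hs.tree_sorted _ hEF
  have hlead := hs.tree_leader _ hEF
  -- Slot `k + 1` has index `k`; header slots are at least `1`, so the truncated subtraction stays
  -- injective.
  have hF : (F.map fun h => h.time - 1).Nodup := by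
    have h1 := (List.pairwise_append.1 hsort).2.1
    rw [List.Nodup, List.pairwise_map]
    refine h1.imp_of_mem ?_
    intro a b ha hb hab
    have := (hlead a (List.mem_append_right _ ha)).1
    have := (hlead b (List.mem_append_right _ hb)).1
    omega
  rw [← List.length_map (as := F) (fun h => h.time - 1), ← List.toFinset_card_of_nodup hF]
  apply Finset.card_le_card
  intro k hk
  rw [List.mem_toFinset, List.mem_map] at hk
  obtain ⟨h, hh, rfl⟩ := hk
  obtain ⟨h1, h2, h3, h4⟩ := hlead h (List.mem_append_right _ hh)
  have h5 : tipTime E < h.time := by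
    rcases List.eq_nil_or_concat E with rfl | ⟨E', g, rfl⟩
    · exact h1
    · rw [List.concat_eq_append] at *
      rw [tipTime_append]
      exact (List.pairwise_append.1 hsort).2.2 g (by simp) h hh
  rw [Finset.mem_filter, Finset.mem_Ico, Nat.sub_add_cancel h1]
  refine ⟨by omega, ⟨h.node, h4, h3⟩, ?_⟩
  rintro ⟨P, hP⟩
  obtain ⟨F₁, F₂, rfl⟩ := List.append_of_mem hh
  have h6 : tipTime (E ++ F₁ ++ [h]) = h.time := tipTime_append _ _
  refine hno (E ++ F₁ ++ [h]) ⟨F₂, by simp⟩ P ?_ ?_ <;> rw [h6]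
  · exact h5
  · exact hP

open Classical in
/-- The block of a pivot slot stays in the longest chains of all honest nodes. -/
theorem Run.block_prefix (R : Run p sys T) (hp : Function.Injective p.hash)
    (hdis : Disjoint sys.honest sys.corrupt) {n u P : ℕ} (hn : n ≤ T) (hR : R.Prompt n)
    (hpiv : IsPivot (slotStep sys) T u) (hP : UniqueLeader sys P u) :
    ∀ m, u ≤ m → m ≤ n → ∀ i ∈ sys.honest, R.block P u <+: ((R.state m).node i).longest := by
  intro m
  induction m using Nat.strong_induction_on with
  | _ m ih =>
  intro hum hmn i hi
  by_contra hcon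
  obtain ⟨hs, ho, hslot, -⟩ := R.invariants hp hdis m (by omega)
  have hni := hs.nodes i hi
  set L := ((R.state m).node i).longest with hL
  have hLt : L ∈ (R.state m).tree := hs.headers_sub i hi hni.longest.1
  -- From slot `u` on, `L` holds no block of a unique leader: one from `u` would be the pivot block,
  -- and a later one extends a chain containing it by the induction hypothesis.
  have hlate : ∀ C, C <+: L → ∀ Q, u ≤ tipTime C → ¬ UniqueLeader sys Q (tipTime C) := by
    intro C hC Q hu hQ
    have hCt := hs.tree_prefix L hLt C hC
    have hCm := hs.tipTime_le hCt
    have hCQ := eq_block_of_tipTime hs ho hQ hCt rfl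
    rcases hu.eq_or_lt with h | h
    · rw [← h] at hCQ hQ
      rw [hP.eq hQ] at hCQ
      exact hcon (hCQ ▸ hC)
    · obtain ⟨v, hv⟩ : ∃ v, tipTime C = v + 1 := ⟨tipTime C - 1, by omega⟩
      rw [hv] at hCQ
      rw [R.block_succ hp hdis (by omega)] at hCQ
      have h1 := ih v (by omega) (by omega) (by omega) Q hQ.honest
      refine hcon (h1.trans (List.IsPrefix.trans ?_ hC))
      rw [hCQ]
      exact List.prefix_append _ _
  -- The fork point: `E` is the last prefix of `L` before slot `u` that ends in a block of a unique
  -- leader, or genesis.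
  let A : ℕ → Prop := fun r => ∃ E, E <+: L ∧ tipTime E = r ∧
    (E = [] ∨ ∃ Q, UniqueLeader sys Q r ∧ E = R.block Q r)
  have hA0 : A 0 := ⟨[], List.nil_prefix, rfl, Or.inl rfl⟩
  obtain ⟨E, ⟨F, hEF⟩, hEt, hE⟩ := Nat.findGreatest_spec (P := A) (Nat.zero_le (u - 1)) hA0
  have hru : Nat.findGreatest A (u - 1) < u := by
    have := Nat.findGreatest_le (P := A) (u - 1)
    have := hpiv.pos
    omega
  have hmax : ∀ k, Nat.findGreatest A (u - 1) < k → k ≤ u - 1 → ¬ A k :=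
    fun k h1 h2 => Nat.findGreatest_is_greatest h1 h2
  generalize Nat.findGreatest A (u - 1) = r at *
  have hlen := hs.length_le_of_no_unique (E := E) (F := F) hslot (hEF.symm ▸ hLt) (by
    intro C hC Q hlt hQ
    rw [hEF] at hC
    by_cases h : u ≤ tipTime C
    · exact hlate C hC Q h hQ
    · refine hmax (tipTime C) (by omega) (by omega) ⟨C, hC, rfl, Or.inr ⟨Q, hQ, ?_⟩⟩
      exact eq_block_of_tipTime hs ho hQ (hs.tree_prefix L hLt C hC) rfl)
  -- By promptness every honest node has `E` at the end of slot `r`, so all grow from at least that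
  -- length.
  have hgrow := R.growth hp hdis hn hR (r := r) (m := m) (l := E.length) (by omega) hmn (by
    intro j hj
    rcases hE with rfl | ⟨Q, hQ, rfl⟩
    · exact Nat.zero_le _
    · exact R.length_le hp hdis hj (by omega) (hR Q r hQ (by omega) j hj)) i hi
  rw [← hL, ← hEF, List.length_append] at hgrow
  -- `F` has at least as many blocks as there are `1` steps between `r` and `m`, and at most as many
  -- as there are `-1` steps. This contradicts the positive sum around the pivot.
  have hsum := sum_slotStep (sys := sys) (r := r) (s := m) (by omega)
  have hpos := hpiv.lt r m hru hum (by omega)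
  rw [hEt] at hlen
  omega

end PivotLemmas

/-! ### From dense pivots to promptness, safety and liveness -/

/-- Every window of `w` slots within the horizon has a pivot. -/
def PivotDense (x : ℕ → ℤ) (T w : ℕ) : Prop :=
  ∀ a, a + w ≤ T → ∃ u, a < u ∧ u ≤ a + w ∧ IsPivot x T u

section SecurityLemmas

variable {Tx Digest : Type*} {p : Params Tx Digest} {sys : System Tx} {T : ℕ}

/-- A chain has at most one block per slot. Positive slots are needed when `D` is genesis, whose tip
time is `0`. -/
theorem length_sub_le {C D : Chain Digest} (hC : C.Pairwise (fun a b => a.time < b.time))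
    (hpos : ∀ h ∈ C, 1 ≤ h.time) (hD : D <+: C) :
    C.length - D.length ≤ tipTime C - tipTime D := by
  obtain ⟨E, rfl⟩ := hD
  induction E using List.reverseRecOn with
  | nil => simp
  | append_singleton E g ih =>
    rw [← List.append_assoc] at hC hpos ⊢
    have h1 := List.pairwise_append.1 hC
    have h2 := ih h1.1 fun h hh => hpos h (List.mem_append_left _ hh)
    rw [tipTime_append, List.length_append, List.length_singleton]
    have h3 : ∀ h ∈ D ++ E, h.time < g.time := fun h hh => h1.2.2 h hh g (by simp)
    have h4 : (D ++ E).length - D.length = E.length := by simp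
    have h6 : tipTime D ≤ tipTime (D ++ E) := by
      rcases List.eq_nil_or_concat D with rfl | ⟨D', g', rfl⟩
      · exact Nat.zero_le _
      · rw [List.concat_eq_append, tipTime_append, ← List.concat_eq_append]
        exact time_le_tipTime h1.1 (by simp)
    rcases List.eq_nil_or_concat (D ++ E) with h | ⟨D', g', h⟩
    · obtain ⟨rfl, rfl⟩ := List.append_eq_nil_iff.1 h
      have := hpos g (by simp)
      simpa [tipTime_nil] using this
    · rw [List.concat_eq_append] at h
      have := h3 g' (by rw [h]; simp)
      rw [h, tipTime_append] at h2 h6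
      rw [h] at h4 ⊢
      omega

theorem takeWhile_prefix_takeWhile {α : Type*} {f g : α → Bool} (h : ∀ a, f a → g a)
    (l : List α) : l.takeWhile f <+: l.takeWhile g := by
  induction l with
  | nil => exact List.prefix_rfl
  | cons a l ih =>
    by_cases hf : f a
    · simpa [hf, h a hf] using ih
    · simp [hf]

theorem truncate_prefix (Tconf t : ℕ) (C : Chain Digest) : truncate Tconf t C <+: C :=
  List.takeWhile_prefix _

theorem truncate_mono (Tconf : ℕ) {t t' : ℕ} (h : t ≤ t') (C : Chain Digest) :
    truncate Tconf t C <+: truncate Tconf t' C := by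
  apply takeWhile_prefix_takeWhile
  intro a ha
  simp only [decide_eq_true_eq] at ha ⊢
  omega

/-- The last block of `B` is already beyond the cutoff, so `takeWhile` stops inside `B` and never
sees the rest of `C`. -/
theorem truncate_eq_of_prefix {Tconf t : ℕ} {B C : Chain Digest} (h : B <+: C) (hB : B ≠ [])
    (ht : t < tipTime B + Tconf) : truncate Tconf t C = truncate Tconf t B := by
  obtain ⟨E, rfl⟩ := h
  rcases List.eq_nil_or_concat B with rfl | ⟨B', g, rfl⟩
  · exact absurd rfl hB
  · rw [List.concat_eq_append] at *
    rw [tipTime_append] at ht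
    have hg : ¬ (g.time + Tconf ≤ t) := by omega
    unfold truncate
    rw [List.append_assoc]
    simp [List.takeWhile_append, hg]

theorem prefix_truncate {Tconf t : ℕ} {B C : Chain Digest} (h : B <+: C)
    (hB : B.Pairwise (fun a b => a.time < b.time)) (ht : tipTime B + Tconf ≤ t) :
    B <+: truncate Tconf t C := by
  obtain ⟨E, rfl⟩ := h
  unfold truncate
  rw [List.takeWhile_append_of_pos]
  · exact List.prefix_append _ _
  · intro a ha
    have := time_le_tipTime hB ha
    simp only [decide_eq_true_eq]
    omega

theorem Run.block_sorted (R : Run p sys T) (hp : Function.Injective p.hash)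
    (hdis : Disjoint sys.honest sys.corrupt) {t P : ℕ} (ht : t ≤ T)
    (hu : UniqueLeader sys P (t + 1)) :
    (R.block P (t + 1)).Pairwise (fun a b => a.time < b.time) ∧
      ∀ h ∈ R.block P (t + 1), 1 ≤ h.time := by
  obtain ⟨h1, -, h3, -⟩ := R.invariants hp hdis t ht
  have h4 := h1.startSlot (R.txs (t + 1))
  have hm : R.block P (t + 1) ∈ ((R.state t).startSlot p sys (R.txs (t + 1))).tree :=
    Or.inr ⟨P, hu.honest, by rw [h3]; exact hu.leader,
      by rw [R.block_succ hp hdis ht, proposal, h3]⟩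
  exact ⟨h4.tree_sorted _ hm, fun h hh => (h4.tree_leader _ hm h hh).1⟩

/-- If pivots are dense with respect to the capacity of a slot, all honest nodes download the
proposals of unique leaders in time. -/
theorem Run.prompt (R : Run p sys T) (hp : Function.Injective p.hash)
    (hdis : Disjoint sys.honest sys.corrupt) (hrule : p.rule = freshestBlockRule Tx Digest)
    (hdelay : 0 ≤ p.headerDelay) (hbw : 0 < p.bandwidth) {w : ℕ} (hw : 0 < w)
    (hK : w ≤ p.slotCapacity) (hpiv : PivotDense (slotStep sys) T w) :
    ∀ n ≤ T, R.Prompt n := by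
  intro n
  induction n with
  | zero => exact fun _ P u hu h0 => absurd hu.pos (by omega)
  | succ n ih =>
    intro hn P u hu hun i hi
    have hR := ih (by omega)
    rcases Nat.lt_or_ge n u with h | h
    swap
    · exact hR P u hu h i hi
    obtain rfl : u = n + 1 := by omega
    refine R.downloaded_block hp hdis hrule hdelay hbw (by omega) hn hu hi (le_trans ?_ hK)
    obtain ⟨hs, -, -, -⟩ := R.invariants hp hdis n (by omega)
    have hb := R.block_succ hp hdis (by omega : n ≤ T) P
    have htip : tipTime (R.block P (n + 1)) = n + 1 := by rw [hb, tipTime_append]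
    obtain ⟨hsort, hpos⟩ := R.block_sorted hp hdis (by omega) hu
    rcases Nat.lt_or_ge n w with hnw | hnw
    -- Early slots need no pivot: even counted from genesis the chain has at most `n + 1 ≤ w`
    -- blocks.
    · have h1 := (hs.nodes i hi).missing_le (List.nil_prefix (l := R.block P (n + 1)))
        (hs.nodes i hi).nil_known
      have h2 := length_sub_le hsort hpos List.nil_prefix
      rw [tipTime_nil] at h2
      omega
    -- A pivot `v` with `n - w < v ≤ n`: its block is on the leader's chain and already downloaded
    -- by `i`, so at most `n + 1 - v ≤ w` blocks are missing.
    · obtain ⟨v, hv1, hv2, hv⟩ := hpiv (n - w) (by omega)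
      obtain ⟨Q, hQ⟩ := hv.uniqueLeader (by omega)
      have h1 := R.block_prefix hp hdis (by omega) hR hv hQ n (by omega) le_rfl P hu.honest
      have h2 : R.block Q v <+: R.block P (n + 1) := by
        rw [hb]; exact h1.trans (List.prefix_append _ _)
      have h3 := (hs.nodes i hi).missing_le h2 (R.known_mono hp hdis hi (by omega) (by omega)
        (hR Q v hQ (by omega) i hi))
      have h4 := length_sub_le hsort hpos h2
      have h5 : tipTime (R.block Q v) = v := by rw [Run.block, proposal, tipTime_append,
        (R.invariants hp hdis (v - 1) (by omega)).2.2.1]; dsimp only; omega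
      omega

theorem Run.tipTime_block (R : Run p sys T) (hp : Function.Injective p.hash)
    (hdis : Disjoint sys.honest sys.corrupt) {u P : ℕ} (h0 : 1 ≤ u) (hu : u ≤ T) :
    tipTime (R.block P u) = u := by
  obtain ⟨v, rfl⟩ : ∃ v, u = v + 1 := ⟨u - 1, by omega⟩
  rw [R.block_succ hp hdis (by omega), tipTime_append]

theorem Run.log_eq (R : Run p sys T) (hp : Function.Injective p.hash)
    (hdis : Disjoint sys.honest sys.corrupt) {i t : ℕ} (ht : t ≤ T) (hi : i ∈ sys.honest) :
    R.LOG i t = canonLedger p (R.confirmed i t) := by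
  have hn := (R.invariants hp hdis t ht).1.nodes i hi
  exact hn.ledger_eq (hn.known_prefix _ hn.longest.2.1 _ (truncate_prefix _ _ _))

/-- A pivot among the last `Tconf` slots before `t` has its block in both longest chains and beyond
the cutoff. At cutoff `t - Tconf` both chains are truncations of that block. -/
theorem Run.confirmed_prefix (R : Run p sys T) (hp : Function.Injective p.hash)
    (hdis : Disjoint sys.honest sys.corrupt) (hR : R.Prompt T) {w : ℕ}
    (hconf : w ≤ p.Tconf) (hpiv : PivotDense (slotStep sys) T w) {t t' i j : ℕ} (htt : t ≤ t')
    (ht : t' ≤ T) (hi : i ∈ sys.honest) (hj : j ∈ sys.honest) :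
    R.confirmed i t <+: R.confirmed j t' := by
  refine List.IsPrefix.trans ?_ (truncate_mono p.Tconf htt _)
  rcases Nat.lt_or_ge t p.Tconf with h | h
  · have : R.confirmed i t = [] := by
      unfold Run.confirmed truncate
      cases ((R.state t).node i).longest with
      | nil => rfl
      | cons a l =>
        have : ¬ (a.time + p.Tconf ≤ t) := by omega
        simp [this]
    rw [this]
    exact List.nil_prefix
  · obtain ⟨u, hu1, hu2, hu⟩ := hpiv (t - p.Tconf) (by omega)
    obtain ⟨P, hP⟩ := hu.uniqueLeader (by omega)
    have h1 := R.block_prefix hp hdis le_rfl hR hu hP t (by omega) (by omega) i hi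
    have h2 := R.block_prefix hp hdis le_rfl hR hu hP t' (by omega) (by omega) j hj
    have h3 := R.tipTime_block hp hdis (P := P) hu.pos (by omega)
    have h4 : R.block P u ≠ [] := by simp [Run.block, proposal]
    unfold Run.confirmed
    rw [truncate_eq_of_prefix h1 h4 (by omega), truncate_eq_of_prefix h2 h4 (by omega)]

theorem Run.safe (R : Run p sys T) (hp : Function.Injective p.hash)
    (hdis : Disjoint sys.honest sys.corrupt) (hR : R.Prompt T) {w : ℕ}
    (hconf : w ≤ p.Tconf) (hpiv : PivotDense (slotStep sys) T w) : R.Safe := by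
  intro t ht t' ht' i hi j hj
  rw [R.log_eq hp hdis ht hi, R.log_eq hp hdis ht' hj]
  rcases le_total t t' with h | h
  · have := R.confirmed_prefix hp hdis hR hconf hpiv h ht' hi hj
    exact ⟨Or.inl this, Or.inl (canonLedger_prefix p this)⟩
  · have := R.confirmed_prefix hp hdis hR hconf hpiv h ht hj hi
    exact ⟨Or.inr this, Or.inr (canonLedger_prefix p this)⟩

/-- A pivot leader in `(t, t + w]` has `x` in its chain once it has proposed, since it omits no
pending valid transaction. Its block persists and is `Tconf` slots old by time `t + Tlive`. -/
theorem Run.live (R : Run p sys T) (hp : Function.Injective p.hash)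
    (hdis : Disjoint sys.honest sys.corrupt)
    (hpool : ∀ P s t, s ≤ t → sys.pool P s ⊆ sys.pool P t) (hR : R.Prompt T) {w Tlive : ℕ}
    (hlive : p.Tconf + w ≤ Tlive) (hpiv : PivotDense (slotStep sys) T w) : R.Live Tlive := by
  intro x t hx hval i hi t' ht' htt
  obtain ⟨u, hu1, hu2, hu⟩ := hpiv t (by omega)
  obtain ⟨P, hP⟩ := hu.uniqueLeader (by omega)
  obtain ⟨v, rfl⟩ : ∃ v, u = v + 1 := ⟨u - 1, by omega⟩
  have h1 := R.block_prefix hp hdis le_rfl hR hu hP t' (by omega) ht' i hi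
  have hn := (R.invariants hp hdis v (by omega)).1.nodes P hP.honest
  have hmem : x ∈ (R.state v).ledgerOf P ++ R.txs (v + 1) P := by
    rcases hval v (by omega) (by omega) (by omega) P hP.honest hP.leader with h | h
    · exact h
    · have hslot := (R.invariants hp hdis v (by omega)).2.2.1
      rcases (R.proposals v (by omega) P hP.honest hP.leader).2.2 x
        (hpool P t _ (by omega) (hx P hP.honest)) with h' | h'
      · exact h'
      · exact absurd h h'
  rw [R.log_eq hp hdis ht' hi]
  refine (canonLedger_prefix p (prefix_truncate h1 (R.block_sorted hp hdis (by omega) hP).1 ?_)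
    ).subset ?_
  · rw [R.tipTime_block hp hdis hu.pos (by omega)]
    omega
  · have hc := R.canon_block hp P (v + 1)
    rw [R.block_succ hp hdis (by omega)] at hc ⊢
    rw [canonLedger_concat, hc, ← hn.ledger_eq hn.longest.2.1]
    exact hmem

end SecurityLemmas

/-! ### An online search for pivots -/

/-- The state of an automaton that looks for a pivot while reading a walk. `drop` is the distance of
the walk to its maximum. In `search wait drop` there is no candidate, and none is chosen during the
next `wait` steps; in `track height drop` the walk is by `height` above its value at the candidate,
and it has not fallen below that value. -/
inductive Scan where
  | search (wait drop : ℕ)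
  | track (height drop : ℕ)

/-- The transition of the automaton when the walk makes the step `z`. -/
def Scan.next : Scan → ℤ → Scan
  | .search (w + 1) d, z =>
    if z = 1 then .search w (d - 1) else if z = -1 then .search w (d + 1) else .search w d
  | .search 0 d, z =>
    if z = 1 then (if d = 0 then .track 0 0 else .search 0 (d - 1))
    else if z = -1 then .search 0 (d + 1) else .search 0 d
  | .track h d, z =>
    if z = 1 then .track (h + 1) (d - 1)
    else if z = -1 then (if h = 0 then .search 0 (d + 1) else .track (h - 1) (d + 1))
    else .track h d

/-- The state reached from `σ` after the first `k` steps of the walk. -/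
def scan (σ : Scan) (x : ℕ → ℤ) : ℕ → Scan
  | 0 => σ
  | k + 1 => (scan σ x k).next (x k)

theorem scan_succ' (σ : Scan) (x : ℕ → ℤ) (k : ℕ) :
    scan σ x (k + 1) = scan (σ.next (x 0)) (fun j => x (j + 1)) k := by
  induction k with
  | zero => rfl
  | succ k ih => rw [scan, ih, scan]

/-- The partial sums of a walk. -/
def psum (x : ℕ → ℤ) (n : ℕ) : ℤ := ∑ k ∈ Finset.range n, x k

theorem psum_succ (x : ℕ → ℤ) (n : ℕ) : psum x (n + 1) = psum x n + x n :=
  Finset.sum_range_succ _ _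

/-- The walk is by `d` below its maximum at time `n`. -/
def HasDrop (x : ℕ → ℤ) (n d : ℕ) : Prop :=
  (∀ r ≤ n, psum x r ≤ psum x n + d) ∧ ∃ r ≤ n, psum x r = psum x n + d

/-- At time `n`, the time `c` may still be a pivot, and the walk is by `h` above its value at
`c`. -/
structure Candidate (x : ℕ → ℤ) (n c h : ℕ) : Prop where
  le : c ≤ n
  lt : ∀ r s, r < c → c ≤ s → s ≤ n → psum x r < psum x s
  height : psum x n = psum x c + h

variable {x : ℕ → ℤ} {n d c h : ℕ}

theorem HasDrop.up (H : HasDrop x n d) (hx : x n = 1) : HasDrop x (n + 1) (d - 1) := by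
  have hs := psum_succ x n
  obtain ⟨h1, r, hr, h2⟩ := H
  refine ⟨fun r hr => ?_, ?_⟩
  · rcases hr.eq_or_lt with rfl | hr
    · omega
    · have := h1 r (by omega); omega
  · by_cases hd : d = 0
    · exact ⟨n + 1, le_rfl, by simp [hd]⟩
    · exact ⟨r, by omega, by omega⟩

theorem HasDrop.down (H : HasDrop x n d) (hx : x n = -1) : HasDrop x (n + 1) (d + 1) := by
  have hs := psum_succ x n
  obtain ⟨h1, r, hr, h2⟩ := H
  refine ⟨fun r hr => ?_, r, by omega, by push_cast; omega⟩
  rcases hr.eq_or_lt with rfl | hr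
  · push_cast; omega
  · have := h1 r (by omega)
    push_cast; omega

theorem HasDrop.stay (H : HasDrop x n d) (hx : x n = 0) : HasDrop x (n + 1) d := by
  have hs := psum_succ x n
  obtain ⟨h1, r, hr, h2⟩ := H
  refine ⟨fun r hr => ?_, r, by omega, by omega⟩
  rcases hr.eq_or_lt with rfl | hr
  · omega
  · have := h1 r (by omega)
    omega

theorem Candidate.step (H : Candidate x n c h) {h' : ℕ} (hx : (h : ℤ) + x n = h') :
    Candidate x (n + 1) c h' := by
  have hs := psum_succ x n
  obtain ⟨h1, h2, h3⟩ := H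
  refine ⟨by omega, fun r s hr hcs hsn => ?_, by omega⟩
  rcases hsn.eq_or_lt with rfl | hsn
  · have := h2 r c hr le_rfl h1
    omega
  · exact h2 r s hr hcs (by omega)

/-- An upward step from drop `0` reaches a new strict maximum, which is all that the past demands of
a pivot. -/
theorem HasDrop.candidate (H : HasDrop x n 0) (hx : x n = 1) :
    Candidate x (n + 1) (n + 1) 0 := by
  have hs := psum_succ x n
  refine ⟨le_rfl, fun r s hr hcs hsn => ?_, by simp⟩
  obtain rfl : s = n + 1 := by omega
  have := H.1 r (by omega)
  push_cast at this
  omega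

/-- What the state `σ` of the automaton, started in `search a 0`, says about the walk. -/
def Scan.Sound (x : ℕ → ℤ) (a n : ℕ) : Scan → Prop
  | .search w d => w = a - n ∧ HasDrop x n d
  | .track h d => a ≤ n ∧ HasDrop x n d ∧ ∃ c, a < c ∧ Candidate x n c h

theorem scan_sound (hx : ∀ k, x k = 1 ∨ x k = -1 ∨ x k = 0) (a n : ℕ) :
    (scan (.search a 0) x n).Sound x a n := by
  induction n with
  | zero => exact ⟨rfl, fun r hr => by simp [Nat.le_zero.1 hr], 0, le_rfl, by simp⟩
  | succ n ih =>
    rw [scan]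
    generalize scan (.search a 0) x n = σ at ih
    cases σ with
    | search w d =>
      obtain ⟨h1, h2⟩ := ih
      cases w with
      | zero =>
        rcases hx n with h | h | h <;> simp only [Scan.next, h]
        · by_cases hd : d = 0
          · subst hd
            exact ⟨by omega, h2.up h, n + 1, by omega, h2.candidate h⟩
          · simp only [hd, if_true, if_false]
            exact ⟨by omega, h2.up h⟩
        · exact ⟨by omega, h2.down h⟩
        · exact ⟨by omega, h2.stay h⟩
      | succ w =>
        rcases hx n with h | h | h <;> simp only [Scan.next, h]
        · exact ⟨by omega, h2.up h⟩
        · exact ⟨by omega, h2.down h⟩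
        · exact ⟨by omega, h2.stay h⟩
    | track u d =>
      obtain ⟨h1, h2, c, hc, h3⟩ := ih
      rcases hx n with h | h | h <;> simp only [Scan.next, h]
      · exact ⟨by omega, h2.up h, c, hc, h3.step (by rw [h]; push_cast; ring)⟩
      · by_cases hu : u = 0
        · simp only [hu, if_true]
          exact ⟨by omega, h2.down h⟩
        · simp only [hu, if_false]
          exact ⟨by omega, h2.down h, c, hc, h3.step (by rw [h]; omega)⟩
      · exact ⟨by omega, h2.stay h, c, hc, h3.step (by rw [h]; ring)⟩

/-- The automaton has no candidate. -/
def Scan.IsSearch : Scan → Prop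
  | .search _ _ => True
  | .track _ _ => False

/-- A candidate can be replaced only after passing through a search state. Without one from `m` to
`T`, the candidate at `m` survives to the horizon and is a pivot. -/
theorem exists_pivot_of_scan (hx : ∀ k, x k = 1 ∨ x k = -1 ∨ x k = 0) {a m T : ℕ} (hm : m ≤ T)
    (hscan : ∀ n, m ≤ n → n ≤ T → ¬ (scan (.search a 0) x n).IsSearch) :
    ∃ u, a < u ∧ u ≤ m ∧ IsPivot x T u := by
  have key : ∀ n, m ≤ n → n ≤ T → ∃ c h d, a < c ∧ c ≤ m ∧ Candidate x n c h ∧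
      scan (.search a 0) x n = .track h d := by
    intro n hn
    induction n, hn using Nat.le_induction with
    | base =>
      intro _
      have h1 := scan_sound hx a m
      have h2 := hscan m le_rfl hm
      generalize scan (.search a 0) x m = σ at *
      cases σ with
      | search w d => exact absurd trivial h2
      | track h d =>
        obtain ⟨-, -, c, hc, h3⟩ := h1
        exact ⟨c, h, d, hc, h3.le, h3, rfl⟩
    | succ n hmn ih =>
      intro hnT
      obtain ⟨c, h, d, h1, h2, h3, h4⟩ := ih (by omega)
      have h5 := hscan (n + 1) (by omega) hnT
      rw [scan, h4] at h5 ⊢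
      rcases hx n with hz | hz | hz <;> simp only [Scan.next, hz] at h5 ⊢
      · exact ⟨c, h + 1, d - 1, h1, h2, h3.step (by rw [hz]; push_cast; ring), rfl⟩
      · by_cases hu : h = 0
        · simp [hu, Scan.IsSearch] at h5
        · exact ⟨c, h - 1, d + 1, h1, h2, h3.step (by rw [hz]; omega), by simp [hu]⟩
      · exact ⟨c, h, d, h1, h2, h3.step (by rw [hz]; ring), rfl⟩
  obtain ⟨c, h, d, h1, h2, h3, -⟩ := key T hm le_rfl
  exact ⟨c, h1, h2, by omega, h3.lt⟩

theorem pivotDense_of_scan (hx : ∀ k, x k = 1 ∨ x k = -1 ∨ x k = 0) {w T : ℕ}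
    (hscan : ∀ a n, a + w ≤ n → n ≤ T → ¬ (scan (.search a 0) x n).IsSearch) :
    PivotDense x T w :=
  fun a ha => exists_pivot_of_scan hx ha (hscan a)

/-- Needed because `walk` rests after the horizon, while `slotStep` need not. -/
theorem PivotDense.congr {x' : ℕ → ℤ} {T w : ℕ} (h : PivotDense x T w)
    (hx : ∀ k < T, x k = x' k) : PivotDense x' T w := by
  intro a ha
  obtain ⟨u, h1, h2, h3⟩ := h a ha
  refine ⟨u, h1, h2, h3.pos, fun r s hr hus hs => ?_⟩
  have := h3.lt r s hr hus hs
  rwa [Finset.sum_congr rfl fun k hk => hx k (by rw [Finset.mem_range] at hk; omega),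
    Finset.sum_congr rfl fun k hk => hx k (by rw [Finset.mem_range] at hk; omega)] at this

/-! ## Exponential decay of the probability to have no candidate -/

/-- The weights of the exponential potential of the automaton. -/
structure Weights (p q r θ y γ : ℝ) : Prop where
  p_nonneg : 0 ≤ p
  q_nonneg : 0 ≤ q
  r_nonneg : 0 ≤ r
  sum : p + q + r = 1
  one_le : 1 ≤ θ
  y_pos : 0 < y
  γ_pos : 0 < γ
  γ_lt : γ < 1
  search_pos : p + q * θ ^ 2 + r * θ ≤ γ * θ
  search_zero : p * (y * θ) + q * θ + r ≤ γ
  track_pos : p * y ^ 2 + q + r * y ≤ γ * y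
  track_zero : p * (y ^ 2 * θ) + q + r * y ≤ γ * y

theorem exists_weights {p q r : ℝ} (hq : 0 < q) (hqp : q < p) (hr : 0 ≤ r) (h : p + q + r = 1) :
    ∃ θ y γ, Weights p q r θ y γ := by
  have hp : 0 < p := hq.trans hqp
  -- At `θ = 1` the gap in `track_zero` is `(1 - y) * (q - p * y) < 0`, and `search_zero` is strict
  -- since `y < 1`. Both persist for `θ` slightly above `1`.
  obtain ⟨y, hy1, hy2⟩ : ∃ y, q / p < y ∧ y < 1 := exists_between ((div_lt_one hp).2 hqp)
  have hy0 : 0 < y := (div_pos hq hp).trans hy1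
  have hy3 : q < p * y := by rwa [div_lt_iff₀' hp] at hy1
  have e1 : ∀ᶠ θ : ℝ in nhdsWithin 1 (Set.Ioi 1), p * (y * θ) + q * θ + r < 1 := by
    apply Filter.Eventually.filter_mono nhdsWithin_le_nhds
    have hc : Continuous fun θ : ℝ => p * (y * θ) + q * θ + r := by fun_prop
    exact hc.continuousAt.eventually_lt continuousAt_const (by nlinarith)
  have e2 : ∀ᶠ θ : ℝ in nhdsWithin 1 (Set.Ioi 1), p * (y ^ 2 * θ) + q + r * y < y := by
    apply Filter.Eventually.filter_mono nhdsWithin_le_nhds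
    have hc : Continuous fun θ : ℝ => p * (y ^ 2 * θ) + q + r * y := by fun_prop
    refine hc.continuousAt.eventually_lt continuousAt_const ?_
    have : r = 1 - p - q := by linarith
    subst this
    nlinarith [mul_pos (sub_pos.2 hy2) (sub_pos.2 hy3)]
  have e3 : ∀ᶠ θ : ℝ in nhdsWithin 1 (Set.Ioi 1), q * θ < p := by
    apply Filter.Eventually.filter_mono nhdsWithin_le_nhds
    have hc : Continuous fun θ : ℝ => q * θ := by fun_prop
    exact hc.continuousAt.eventually_lt continuousAt_const (by linarith)
  obtain ⟨θ, ⟨⟨h1, h2⟩, h3⟩, h4⟩ :=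
    (((e1.and e2).and e3).and self_mem_nhdsWithin).exists
  have h4 : 1 < θ := h4
  have hθ : 0 < θ := by linarith
  -- The difference of the two sides factors as `(θ - 1) * (q * θ - p)`.
  have h5 : p + q * θ ^ 2 + r * θ < θ := by
    have : r = 1 - p - q := by linarith
    subst this
    nlinarith [mul_pos (sub_pos.2 h4) (sub_pos.2 h3)]
  set A := (p + q * θ ^ 2 + r * θ) / θ
  set B := p * (y * θ) + q * θ + r
  set C := (p * (y ^ 2 * θ) + q + r * y) / y
  have hA : A < 1 := (div_lt_one hθ).2 h5
  have hC : C < 1 := (div_lt_one hy0).2 h2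
  have hA' : A ≤ max A (max B C) := le_max_left _ _
  have hB' : B ≤ max A (max B C) := (le_max_left _ _).trans (le_max_right _ _)
  have hC' : C ≤ max A (max B C) := (le_max_right _ _).trans (le_max_right _ _)
  have hC'' : p * (y ^ 2 * θ) + q + r * y ≤ max A (max B C) * y := (div_le_iff₀ hy0).1 hC'
  refine ⟨θ, y, max A (max B C), hp.le, hq.le, hr, h, h4.le, hy0, ?_, ?_, ?_, hB', ?_, hC''⟩
  · exact lt_of_lt_of_le (by positivity : 0 < A) hA'
  · exact max_lt hA (max_lt h1 hC)
  · exact (div_le_iff₀ hθ).1 hA'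
  · refine le_trans ?_ hC''
    have : p * y ^ 2 * 1 ≤ p * y ^ 2 * θ := by gcongr
    nlinarith

/-- The exponential potential of the automaton. -/
def Scan.pot (θ y : ℝ) : Scan → ℝ
  | .search _ d => θ ^ d
  | .track h d => (y * θ) ^ (h + 1) * θ ^ d

/-- The automaton does not wait. -/
def Scan.Active : Scan → Prop
  | .search w _ => w = 0
  | .track _ _ => True

theorem Scan.Active.next {σ : Scan} (h : σ.Active) (z : ℤ) : (σ.next z).Active := by
  cases σ with
  | search w d =>
    obtain rfl : w = 0 := h
    simp only [Scan.next]
    split_ifs <;> first | rfl | trivial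
  | track u d =>
    simp only [Scan.next]
    split_ifs <;> first | rfl | trivial

section Potential

variable {p q r θ y γ : ℝ}

theorem Weights.pot_nonneg (W : Weights p q r θ y γ) (σ : Scan) : 0 ≤ σ.pot θ y := by
  have := W.one_le
  have := W.y_pos
  have : 0 < θ := by linarith
  cases σ <;> unfold Scan.pot <;> positivity

/-- Searching acts as tracking at height `-1`, whence the exponent `h + 1`. When tracking, a step up
multiplies the potential by `y`, or by `y * θ` at drop `0`, and a step down by `1 / y`, even when it
loses the candidate. Thus the four inequalities of `Weights` cover all cases. -/
theorem Weights.pot_active (W : Weights p q r θ y γ) {σ : Scan} (h : σ.Active) :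
    p * (σ.next 1).pot θ y + q * (σ.next (-1)).pot θ y + r * (σ.next 0).pot θ y ≤
      γ * σ.pot θ y := by
  have h1 := W.one_le
  have hy := W.y_pos
  have hθ : 0 < θ := by linarith
  cases σ with
  | search w d =>
    obtain rfl : w = 0 := h
    cases d with
    | zero =>
      have := W.search_zero
      simp [Scan.next, Scan.pot]
      linarith
    | succ d =>
      have := mul_le_mul_of_nonneg_left W.search_pos (pow_nonneg hθ.le d)
      simp [Scan.next, Scan.pot]
      ring_nf at this ⊢
      linarith
  | track u d =>
    have key : 0 ≤ (y * θ) ^ u * θ ^ d * θ := by positivity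
    cases d with
    | zero =>
      have := mul_le_mul_of_nonneg_left W.track_zero (by positivity : 0 ≤ (y * θ) ^ u * θ)
      cases u with
      | zero =>
        simp [Scan.next, Scan.pot]
        ring_nf at this ⊢
        linarith
      | succ u =>
        simp [Scan.next, Scan.pot]
        ring_nf at this ⊢
        linarith
    | succ d =>
      have := mul_le_mul_of_nonneg_left W.track_pos
        (by positivity : 0 ≤ (y * θ) ^ u * θ ^ d * θ ^ 2)
      cases u with
      | zero =>
        simp [Scan.next, Scan.pot]
        ring_nf at this ⊢
        linarith
      | succ u =>
        simp [Scan.next, Scan.pot]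
        ring_nf at this ⊢
        linarith

/-- At positive drop the potential does not grow in mean. At drop `0` the reflection at the maximum
costs at most an additive `θ`. -/
theorem Weights.pot_wait (W : Weights p q r θ y γ) (d : ℕ) :
    p * θ ^ (d - 1) + q * θ ^ (d + 1) + r * θ ^ d ≤ θ ^ d + θ := by
  have h1 := W.one_le
  have hθ : 0 < θ := by linarith
  have hs := W.sum
  have := W.p_nonneg
  have := W.q_nonneg
  have := W.r_nonneg
  cases d with
  | zero =>
    simp
    nlinarith
  | succ d =>
    have h2 := mul_le_mul_of_nonneg_left W.search_pos (pow_nonneg hθ.le d)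
    have h3 : γ * θ ^ (d + 1) ≤ 1 * θ ^ (d + 1) := by gcongr; exact W.γ_lt.le
    simp
    ring_nf at h2 h3 ⊢
    linarith

end Potential

open MeasureTheory

/-! ### Expected potential of the random walk and the union bound -/

section Walk

variable {α : Type}

/-- The walk with the steps `z (e 0), z (e 1), …`, and then at rest. -/
def walk (z : α → ℤ) {T : ℕ} (e : Fin T → α) (k : ℕ) : ℤ :=
  if h : k < T then z (e ⟨k, h⟩) else 0

theorem walk_cons_zero (z : α → ℤ) {T : ℕ} (a : α) (e : Fin T → α) :
    walk z (Fin.cons a e : Fin (T + 1) → α) 0 = z a := by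
  simp [walk]

theorem walk_cons_succ (z : α → ℤ) {T : ℕ} (a : α) (e : Fin T → α) :
    (fun j => walk z (Fin.cons a e : Fin (T + 1) → α) (j + 1)) = walk z e := by
  funext j
  unfold walk
  by_cases h : j < T
  · rw [dif_pos h, dif_pos (by omega)]
    exact congrArg z (Fin.cons_succ (α := fun _ => α) a e ⟨j, h⟩)
  · rw [dif_neg h, dif_neg (by omega)]

variable [MeasurableSpace α]

/-- The steps are `1`, `-1`, `0` with probability `p`, `q`, `r`. -/
def StepLaw (ν : Measure α) (z : α → ℤ) (p q r : ℝ) : Prop :=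
  ∀ F : ℤ → ENNReal, ∫⁻ a, F (z a) ∂ν =
    ENNReal.ofReal p * F 1 + ENNReal.ofReal q * F (-1) + ENNReal.ofReal r * F 0

variable {ν : Measure α} {z : α → ℤ} {p q r θ y γ : ℝ}

theorem StepLaw.lintegral_ofReal (hν : StepLaw ν z p q r) (hp : 0 ≤ p) (hq : 0 ≤ q) (hr : 0 ≤ r)
    {f : ℤ → ℝ} (hf : ∀ s, 0 ≤ f s) : ∫⁻ a, ENNReal.ofReal (f (z a)) ∂ν =
      ENNReal.ofReal (p * f 1 + q * f (-1) + r * f 0) := by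
  have h1 := mul_nonneg hp (hf 1)
  have h2 := mul_nonneg hq (hf (-1))
  have h3 := mul_nonneg hr (hf 0)
  rw [hν fun s => ENNReal.ofReal (f s), ENNReal.ofReal_add (by positivity) h3,
    ENNReal.ofReal_add h1 h2, ENNReal.ofReal_mul hp, ENNReal.ofReal_mul hq, ENNReal.ofReal_mul hr]

variable [Countable α] [MeasurableSingletonClass α] [IsProbabilityMeasure ν]

theorem lintegral_pi_cons {n : ℕ}
    (f : (Fin (n + 1) → α) → ENNReal) :
    ∫⁻ e, f e ∂(Measure.pi fun _ => ν) =
      ∫⁻ a, ∫⁻ e, f (Fin.cons a e) ∂(Measure.pi fun _ : Fin n => ν) ∂ν := by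
  have h := (measurePreserving_piFinSuccAbove (fun _ : Fin (n + 1) => ν) 0).symm
  rw [← h.lintegral_comp Measurable.of_discrete, lintegral_prod _ (by fun_prop)]
  congr! 5 with a e
  exact Fin.insertNth_zero' a e

theorem lintegral_pot_cons {T k : ℕ} (σ : Scan) :
    ∫⁻ e, ENNReal.ofReal ((scan σ (walk z e) (k + 1)).pot θ y)
        ∂(Measure.pi fun _ : Fin (T + 1) => ν) =
      ∫⁻ a, ∫⁻ e, ENNReal.ofReal ((scan (σ.next (z a)) (walk z e) k).pot θ y)
        ∂(Measure.pi fun _ : Fin T => ν) ∂ν := by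
  rw [lintegral_pi_cons]
  simp only [scan_succ', walk_cons_zero, walk_cons_succ]

theorem lintegral_pot_active (W : Weights p q r θ y γ) (hν : StepLaw ν z p q r) (k : ℕ) :
    ∀ (T : ℕ) (_ : k ≤ T) (σ : Scan) (_ : σ.Active),
      ∫⁻ e, ENNReal.ofReal ((scan σ (walk z e) k).pot θ y) ∂(Measure.pi fun _ : Fin T => ν) ≤
        ENNReal.ofReal (γ ^ k * σ.pot θ y) := by
  induction k with
  | zero => intro T _ σ _; simp [scan]
  | succ k ih =>
    intro T hT σ hσ
    obtain ⟨T, rfl⟩ : ∃ T', T = T' + 1 := ⟨T - 1, by omega⟩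
    have hγ := W.γ_pos.le
    rw [lintegral_pot_cons]
    calc _ ≤ ∫⁻ a, ENNReal.ofReal (γ ^ k * (σ.next (z a)).pot θ y) ∂ν :=
          lintegral_mono fun a => ih T (by omega) _ (hσ.next _)
      _ = ENNReal.ofReal (p * (γ ^ k * (σ.next 1).pot θ y) + q * (γ ^ k * (σ.next (-1)).pot θ y) +
            r * (γ ^ k * (σ.next 0).pot θ y)) :=
          hν.lintegral_ofReal W.p_nonneg W.q_nonneg W.r_nonneg
            (f := fun s => γ ^ k * (σ.next s).pot θ y)
            fun s => mul_nonneg (pow_nonneg hγ k) (W.pot_nonneg _)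
      _ ≤ _ := by
          apply ENNReal.ofReal_le_ofReal
          have := mul_le_mul_of_nonneg_left (W.pot_active hσ) (pow_nonneg hγ k)
          rw [pow_succ]
          linarith

/-- Each of the `w` waiting steps adds at most `θ` to the expected potential; the remaining `k - w`
steps contract it by `γ`. -/
theorem lintegral_pot_wait (W : Weights p q r θ y γ) (hν : StepLaw ν z p q r) (w : ℕ) :
    ∀ (k T : ℕ) (_ : w ≤ k) (_ : k ≤ T) (d : ℕ),
      ∫⁻ e, ENNReal.ofReal ((scan (.search w d) (walk z e) k).pot θ y)
          ∂(Measure.pi fun _ : Fin T => ν) ≤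
        ENNReal.ofReal (γ ^ (k - w) * (θ ^ d + w * θ)) := by
  have hθ : 0 ≤ θ := by linarith [W.one_le]
  have hγ := W.γ_pos.le
  induction w with
  | zero =>
    intro k T _ hT d
    simpa [Scan.pot] using lintegral_pot_active W hν k T hT (.search 0 d) rfl
  | succ w ih =>
    intro k T hk hT d
    obtain ⟨T, rfl⟩ : ∃ T', T = T' + 1 := ⟨T - 1, by omega⟩
    obtain ⟨k, rfl⟩ : ∃ k', k = k' + 1 := ⟨k - 1, by omega⟩
    rw [lintegral_pot_cons]
    let D : ℤ → ℕ := fun s => if s = 1 then d - 1 else if s = -1 then d + 1 else d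
    have hnext : ∀ s, (Scan.search (w + 1) d).next s = .search w (D s) := by
      intro s
      simp only [Scan.next, D]
      split_ifs <;> rfl
    calc _ ≤ ∫⁻ a, ENNReal.ofReal (γ ^ (k - w) * (θ ^ D (z a) + w * θ)) ∂ν :=
          lintegral_mono fun a => by
            dsimp only
            rw [hnext]
            exact ih k T (by omega) (by omega) _
      _ = ENNReal.ofReal (p * (γ ^ (k - w) * (θ ^ D 1 + w * θ)) +
            q * (γ ^ (k - w) * (θ ^ D (-1) + w * θ)) + r * (γ ^ (k - w) * (θ ^ D 0 + w * θ))) :=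
          hν.lintegral_ofReal W.p_nonneg W.q_nonneg W.r_nonneg
            (f := fun s => γ ^ (k - w) * (θ ^ D s + w * θ)) fun s => by positivity
      _ ≤ _ := by
          apply ENNReal.ofReal_le_ofReal
          have h1 := mul_le_mul_of_nonneg_left (W.pot_wait d) (pow_nonneg hγ (k - w))
          have h2 : γ ^ (k - w) * (w * θ) * (p + q + r) = γ ^ (k - w) * (w * θ) := by
            rw [W.sum, mul_one]
          rw [Nat.add_sub_add_right]
          simp only [D]
          push_cast
          linarith

/-- Markov's inequality: the potential of a search state is a power of `θ ≥ 1`, hence at least `1`.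
-/
theorem measure_isSearch_le (W : Weights p q r θ y γ) (hν : StepLaw ν z p q r) {a n T : ℕ}
    (ha : a ≤ n) (hn : n ≤ T) :
    (Measure.pi fun _ : Fin T => ν) {e | (scan (.search a 0) (walk z e) n).IsSearch} ≤
      ENNReal.ofReal (γ ^ (n - a) * (1 + a * θ)) := by
  have h := lintegral_pot_wait W hν a n T ha hn 0
  rw [pow_zero] at h
  refine le_trans ?_ h
  rw [← lintegral_indicator_one MeasurableSet.of_discrete]
  apply lintegral_mono
  intro e
  by_cases he : (scan (.search a 0) (walk z e) n).IsSearch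
  · rw [Set.indicator_of_mem (by exact he)]
    have hpot : 1 ≤ (scan (.search a 0) (walk z e) n).pot θ y := by
      generalize scan (.search a 0) (walk z e) n = σ at *
      cases σ with
      | search w d => exact one_le_pow₀ W.one_le
      | track h d => exact he.elim
    simpa using hpot
  · rw [Set.indicator_of_notMem (by exact he)]
    exact zero_le

theorem measure_not_pivotDense_le (W : Weights p q r θ y γ) (hν : StepLaw ν z p q r)
    (hz : ∀ a, z a = 1 ∨ z a = -1 ∨ z a = 0) (T w : ℕ) :
    (Measure.pi fun _ : Fin T => ν).real {e | ¬ PivotDense (walk z e) T w} ≤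
      (T + 1) ^ 2 * (γ ^ w * (1 + T * θ)) := by
  have hθ : 0 ≤ θ := by linarith [W.one_le]
  have hγ := W.γ_pos.le
  have hx : ∀ (e : Fin T → α) (k : ℕ), walk z e k = 1 ∨ walk z e k = -1 ∨ walk z e k = 0 := by
    intro e k
    unfold walk
    split_ifs
    · exact hz _
    · simp
  let I : Finset (ℕ × ℕ) := {x ∈ Finset.range (T + 1) ×ˢ Finset.range (T + 1) | x.1 + w ≤ x.2}
  let B : ℕ × ℕ → Set (Fin T → α) := fun x =>
    {e | (scan (.search x.1 0) (walk z e) x.2).IsSearch}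
  have hsub : {e | ¬ PivotDense (walk z e) T w} ⊆ ⋃ x ∈ I, B x := by
    intro e he
    by_contra hcon
    apply he
    apply pivotDense_of_scan (hx e)
    intro a n han hn hs
    apply hcon
    simp only [Set.mem_iUnion]
    exact ⟨(a, n), by simp [I]; omega, hs⟩
  have hB : ∀ x ∈ I, (Measure.pi fun _ : Fin T => ν).real (B x) ≤ γ ^ w * (1 + T * θ) := by
    intro x hx
    simp only [I, Finset.mem_filter, Finset.mem_product, Finset.mem_range] at hx
    have h1 := measure_isSearch_le W hν (a := x.1) (n := x.2) (T := T) (by omega) (by omega)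
    refine (ENNReal.toReal_le_of_le_ofReal (by positivity) h1).trans ?_
    have h2 : γ ^ (x.2 - x.1) ≤ γ ^ w := pow_le_pow_of_le_one hγ W.γ_lt.le (by omega)
    have h3 : (x.1 : ℝ) ≤ T := by exact_mod_cast (by omega : x.1 ≤ T)
    gcongr
  calc _ ≤ (Measure.pi fun _ : Fin T => ν).real (⋃ x ∈ I, B x) :=
        measureReal_mono hsub (measure_ne_top _ _)
    _ ≤ ∑ x ∈ I, (Measure.pi fun _ : Fin T => ν).real (B x) := measureReal_biUnion_finset_le _ _
    _ ≤ I.card • (γ ^ w * (1 + T * θ)) := Finset.sum_le_card_nsmul _ _ _ hB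
    _ ≤ _ := by
      have hc : I.card ≤ (T + 1) ^ 2 := by
        refine (Finset.card_filter_le _ _).trans ?_
        rw [Finset.card_product, Finset.card_range, sq]
      rw [nsmul_eq_mul]
      have : (I.card : ℝ) ≤ (T + 1) ^ 2 := by exact_mod_cast hc
      gcongr

end Walk

/-! ### Executions with Poisson numbers of leaders -/

/-- The contribution of a slot with the given numbers of eligible nodes. -/
def countStep (x : ℕ × ℕ) : ℤ := if x = (1, 0) then 1 else if x = (0, 0) then 0 else -1

theorem stepLaw_countStep {ν : Measure (ℕ × ℕ)} [IsProbabilityMeasure ν] {p q r : ℝ}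
    (hp : 0 ≤ p) (hr : 0 ≤ r) (h : p + q + r = 1)
    (h1 : ν {(1, 0)} = ENNReal.ofReal p) (h0 : ν {(0, 0)} = ENNReal.ofReal r) :
    StepLaw ν countStep p q r := by
  intro F
  have hc : ν {(1, 0), (0, 0)}ᶜ = ENNReal.ofReal q := by
    rw [prob_compl_eq_one_sub (MeasurableSet.of_discrete), Set.insert_eq,
      measure_union (by simp) (MeasurableSet.of_discrete), h1, h0, ← ENNReal.ofReal_add hp hr,
      ← ENNReal.ofReal_one, ← ENNReal.ofReal_sub _ (by positivity)]
    congr 1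
    linarith
  have hF : (fun a => F (countStep a)) = fun a =>
      (({(1, 0)} : Set (ℕ × ℕ)).indicator (fun _ => F 1) a +
        ({(1, 0), (0, 0)}ᶜ : Set (ℕ × ℕ)).indicator (fun _ => F (-1)) a) +
        ({(0, 0)} : Set (ℕ × ℕ)).indicator (fun _ => F 0) a := by
    funext a
    by_cases ha : a = (1, 0)
    · simp [countStep, ha]
    · by_cases hb : a = (0, 0) <;> simp [countStep, ha, hb]
  rw [hF, lintegral_add_left Measurable.of_discrete, lintegral_add_left Measurable.of_discrete,
    lintegral_indicator_const MeasurableSet.of_discrete,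
    lintegral_indicator_const MeasurableSet.of_discrete,
    lintegral_indicator_const MeasurableSet.of_discrete, h1, h0, hc]
  ring

theorem slotStep_eq {Tx : Type*} {sys : System Tx} {β : ℝ} {T : ℕ} {e : Execution T}
    (h : sys.Admissible β e) (k : ℕ) (hk : k < T) : walk countStep e k = slotStep sys k := by
  have h1 := h.honestLeaders ⟨k, hk⟩
  have h2 := h.corruptLeaders ⟨k, hk⟩
  dsimp only at h1 h2
  have f1 : {P | P ∈ sys.honest ∧ sys.leader P (k + 1)}.Finite :=
    sys.honest.finite_toSet.subset fun P hP => hP.1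
  have f2 : {P | P ∈ sys.corrupt ∧ sys.leader P (k + 1)}.Finite :=
    sys.corrupt.finite_toSet.subset fun P hP => hP.1
  have hu : (∃ P, UniqueLeader sys P (k + 1)) ↔ e ⟨k, hk⟩ = (1, 0) := by
    rw [Prod.ext_iff, ← h1, ← h2, Set.ncard_eq_zero f2, Set.ncard_eq_one]
    constructor
    · rintro ⟨P, hP⟩
      refine ⟨⟨P, ?_⟩, ?_⟩
      · ext Q
        simp only [Set.mem_ofPred_eq, Set.mem_singleton_iff]
        constructor
        · rintro ⟨hQ, hl⟩
          exact hP.honest_eq Q hQ hl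
        · rintro rfl
          exact ⟨hP.honest, hP.leader⟩
      · ext Q
        simp only [Set.mem_ofPred_eq, Set.mem_empty_iff_false, iff_false, not_and]
        exact hP.corrupt_not Q
    · rintro ⟨⟨P, hP⟩, hc⟩
      have hPm : P ∈ {P | P ∈ sys.honest ∧ sys.leader P (k + 1)} := by rw [hP]; rfl
      refine ⟨P, by omega, hPm.1, hPm.2, fun Q hQ hl => ?_, fun Q hQ hl => ?_⟩
      · have : Q ∈ {P | P ∈ sys.honest ∧ sys.leader P (k + 1)} := ⟨hQ, hl⟩
        rw [hP] at this
        exact this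
      · have : Q ∈ {P | P ∈ sys.corrupt ∧ sys.leader P (k + 1)} := ⟨hQ, hl⟩
        rw [hc] at this
        exact this
  have hn : HasLeader sys (k + 1) ↔ e ⟨k, hk⟩ ≠ (0, 0) := by
    rw [← not_iff_not, not_ne_iff, Iff.comm, Prod.ext_iff, ← h1, ← h2, Set.ncard_eq_zero f1, Set.ncard_eq_zero f2,
      Set.eq_empty_iff_forall_notMem, Set.eq_empty_iff_forall_notMem]
    unfold HasLeader
    simp only [Set.mem_ofPred_eq]
    constructor
    · rintro h ⟨Q, hQ | hQ, hl⟩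
      · exact h.1 Q ⟨hQ, hl⟩
      · exact h.2 Q ⟨hQ, hl⟩
    · intro h
      exact ⟨fun Q hQ => h ⟨Q, Or.inl hQ.1, hQ.2⟩, fun Q hQ => h ⟨Q, Or.inr hQ.1, hQ.2⟩⟩
  unfold walk slotStep countStep
  rw [dif_pos hk]
  by_cases c1 : e ⟨k, hk⟩ = (1, 0)
  · rw [if_pos c1, if_pos (hu.2 c1)]
  · rw [if_neg c1, if_neg (hu.not.2 c1)]
    by_cases c2 : e ⟨k, hk⟩ = (0, 0)
    · rw [if_pos c2, if_neg (hn.not.2 (by simpa using c2))]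
    · rw [if_neg c2, if_pos (hn.2 c2)]

/-- The criterion depends on the leader counts alone, so one event covers all systems and
adversarial strategies at once. -/
theorem safeAndLive_of_pivotDense {Tx Digest : Type*} (p : Params Tx Digest)
    (hp : Function.Injective p.hash) (hrule : p.rule = freshestBlockRule Tx Digest)
    (hdelay : 0 ≤ p.headerDelay) (hbw : 0 < p.bandwidth) {β : ℝ} {Tlive T w : ℕ} (hw : 0 < w)
    (hK : w ≤ p.slotCapacity) (hconf : w ≤ p.Tconf) (hlive : p.Tconf + w ≤ Tlive)
    {e : Execution T} (he : PivotDense (walk countStep e) T w) : SafeAndLive p β Tlive e := by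
  intro sys hsys R
  have hpiv := he.congr (slotStep_eq hsys)
  have hR := R.prompt hp hsys.disjoint hrule hdelay hbw hw hK hpiv T le_rfl
  exact ⟨R.safe hp hsys.disjoint hR hconf hpiv,
    R.live hp hsys.disjoint hsys.pool_mono hR hlive hpiv⟩

theorem exists_executionLaw_bound {β ρ ε₁ : ℝ} (hβ₀ : 0 ≤ β) (hβ₁ : β < 1) (hρ : 0 < ρ)
    (hε₀ : 0 < ε₁) (hε₁ : ε₁ < 1)
    (hunique : (1 - β) * ρ * Real.exp (-ρ) = (1 - Real.exp (-ρ)) / 2 * (1 + ε₁)) :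
    ∃ γ θ : ℝ, 0 < γ ∧ γ < 1 ∧ 1 ≤ θ ∧ ∀ T w : ℕ,
      (executionLaw β ρ T).real {e | ¬ PivotDense (walk countStep e) T w} ≤
        (T + 1) ^ 2 * (γ ^ w * (1 + T * θ)) := by
  have he : Real.exp (-ρ) < 1 := Real.exp_lt_one_iff.2 (by linarith)
  have he0 := Real.exp_pos (-ρ)
  set p := (1 - β) * ρ * Real.exp (-ρ) with hp
  have ha : 0 ≤ (1 - β) * ρ := mul_nonneg (by linarith) hρ.le
  have hb : 0 ≤ β * ρ := mul_nonneg hβ₀ hρ.le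
  have hp0 : 0 ≤ p := mul_nonneg ha he0.le
  -- By `hunique`, the steps `1` and `-1` have probabilities `(1 - exp (-ρ)) / 2` times `1 + ε₁` and
  -- `1 - ε₁`; hence `0 < q < p`.
  have hq : 0 < 1 - p - Real.exp (-ρ) := by nlinarith
  have hqp : 1 - p - Real.exp (-ρ) < p := by nlinarith
  obtain ⟨θ, y, γ, W⟩ := exists_weights hq hqp he0.le (by ring)
  refine ⟨γ, θ, W.γ_pos, W.γ_lt, W.one_le, fun T w => ?_⟩
  refine measure_not_pivotDense_le W ?_ ?_ T w
  · have hsing : ∀ m n : ℕ, ({(m, n)} : Set (ℕ × ℕ)) = {m} ×ˢ {n} := fun m n => by simp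
    have hexp : Real.exp (-((1 - β) * ρ)) * Real.exp (-(β * ρ)) = Real.exp (-ρ) := by
      rw [← Real.exp_add]; congr 1; ring
    apply stepLaw_countStep hp0 he0.le (by ring)
    · rw [hsing, Measure.prod_prod, ProbabilityTheory.poissonMeasure_singleton,
        ProbabilityTheory.poissonMeasure_singleton, ← ENNReal.ofReal_mul (by positivity),
        Real.coe_toNNReal _ ha, Real.coe_toNNReal _ hb]
      congr 1
      rw [hp, ← hexp]
      simp
      ring
    · rw [hsing, Measure.prod_prod, ProbabilityTheory.poissonMeasure_singleton,
        ProbabilityTheory.poissonMeasure_singleton, ← ENNReal.ofReal_mul (by positivity),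
        Real.coe_toNNReal _ ha, Real.coe_toNNReal _ hb]
      congr 1
      rw [← hexp]
      simp
  · intro x
    unfold countStep
    split_ifs <;> simp

theorem negligible_const_mul_exp_neg (C : ℝ) : Negligible fun κ => C * Real.exp (-κ) := by
  intro n _
  have h1 := (Real.tendsto_pow_mul_exp_neg_atTop_nhds_zero n).const_mul C
  rw [mul_zero] at h1
  have h2 := (h1.comp tendsto_natCast_atTop_atTop).eventually_lt_const one_pos
  obtain ⟨κ₀, h3⟩ := Filter.eventually_atTop.1 h2
  refine ⟨κ₀, fun κ hκ => ?_⟩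
  have h4 := h3 κ hκ.le
  have hpos : (0 : ℝ) < (κ : ℝ) ^ n := by
    have : (0 : ℝ) < κ := by exact_mod_cast (Nat.zero_le κ₀).trans_lt hκ
    positivity
  rw [lt_div_iff₀ hpos]
  simp only [Function.comp] at h4
  linarith

end PoSLC

end

/-! ### The choice of constants -/

theorem mainTheorem2 (β ρ ε₁ Δh bw : ℝ) (hβ₀ : 0 ≤ β) (hβ₁ : β < 1) (hρ : 0 < ρ)
    (hε₀ : 0 < ε₁) (hε₁ : ε₁ < 1) (hΔh : 0 ≤ Δh) (hbw : 0 < bw)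
    (hunique : (1 - β) * ρ * Real.exp (-ρ) = (1 - Real.exp (-ρ)) / 2 * (1 + ε₁)) :
    ∃ cτ : ℝ, 0 < cτ ∧ ∃ cT : ℝ, 0 < cT ∧ ∃ negl : ℕ → ℝ, PoSLC.Negligible negl ∧
      ∀ (Tx Digest : Type*) (hash : List Tx → Digest) (valid : List Tx → Tx → Prop)
        (genesisTxs : List Tx), Function.Injective hash →
      ∀ κ Thor K Tconf Tlive : ℕ, 1 ≤ Thor →
        cτ * (κ + Real.log Thor) ≤ PoSLC.slotDuration Δh bw K →
        cT * (κ + Real.log Thor) ^ 2 ≤ Tconf →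
        Tconf + cT * (κ + Real.log Thor) ^ 2 ≤ Tlive →
        1 - negl κ ≤ (PoSLC.executionLaw β ρ Thor).real
          {e | PoSLC.SafeAndLive
            { headerDelay := Δh
              bandwidth := bw
              slotCapacity := K
              Tconf := Tconf
              hash := hash
              valid := valid
              genesisTxs := genesisTxs
              rule := PoSLC.freshestBlockRule Tx Digest : PoSLC.Params Tx Digest }
            β Tlive e} := by
  obtain ⟨γ, θ, hγ₀, hγ₁, hθ, hbound⟩ :=
    PoSLC.exists_executionLaw_bound hβ₀ hβ₁ hρ hε₀ hε₁ hunique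
  have hlog : 0 < -Real.log γ := by have := Real.log_neg hγ₀ hγ₁; linarith
  set c : ℝ := 3 / -Real.log γ with hc
  have hc0 : 0 < c := by positivity
  -- `c + 1` leaves room for rounding `c * x` up, and the summand `Δh` pays for the header delay, as
  -- `x ≥ 1`.
  refine ⟨(c + 1) / bw + Δh, by positivity, c + 1, by positivity,
    fun κ => 8 * θ * Real.exp (-κ), PoSLC.negligible_const_mul_exp_neg _, ?_⟩
  intro Tx Digest hash valid genesisTxs hhash κ T K Tconf Tlive hT hτ hconf hlive
  -- For `κ = 0` the claim is void, since `8 * θ ≥ 1`; otherwise `x ≥ 1`.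
  rcases Nat.eq_zero_or_pos κ with rfl | hκ
  · refine le_trans ?_ MeasureTheory.measureReal_nonneg
    simp
    linarith
  have hT1 : (1 : ℝ) ≤ T := by exact_mod_cast hT
  have hlogT : 0 ≤ Real.log T := Real.log_nonneg hT1
  have hκ1 : (1 : ℝ) ≤ κ := by exact_mod_cast hκ
  set x : ℝ := κ + Real.log T with hx
  have hx1 : 1 ≤ x := by linarith
  set w := ⌈c * x⌉₊ with hw
  have hcx : 0 < c * x := by positivity
  have hw0 : 0 < w := Nat.ceil_pos.2 hcx
  have hw1 : c * x ≤ w := Nat.le_ceil _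
  have hw2 : (w : ℝ) ≤ (c + 1) * x := by
    have := Nat.ceil_lt_add_one hcx.le
    rw [← hw] at this
    linarith
  -- A window linear in `x` suffices; the quadratic latencies enter only through `x ≤ x ^ 2`.
  have hw3 : (w : ℝ) ≤ (c + 1) * x ^ 2 := by
    have : (c + 1) * x ≤ (c + 1) * x ^ 2 := by
      gcongr
      nlinarith
    linarith
  have hK : w ≤ K := by
    unfold PoSLC.slotDuration at hτ
    have h1 : (c + 1) * x / bw ≤ K / bw := by
      have h2 : Δh * 1 ≤ Δh * x := by gcongr
      have h3 : ((c + 1) / bw + Δh) * x = (c + 1) * x / bw + Δh * x := by ring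
      linarith
    have h4 := (div_le_div_iff_of_pos_right hbw).1 h1
    exact_mod_cast hw2.trans h4
  have hconf' : w ≤ Tconf := by exact_mod_cast hw3.trans hconf
  have hlive' : Tconf + w ≤ Tlive := by
    have : (Tconf : ℝ) + w ≤ Tlive := by linarith
    exact_mod_cast this
  have hbad := hbound T w
  have hprob : MeasureTheory.IsProbabilityMeasure (PoSLC.executionLaw β ρ T) := by
    unfold PoSLC.executionLaw
    infer_instance
  have hγw : γ ^ w ≤ Real.exp (-κ) / T ^ 3 := by
    have h1 : γ ^ w = Real.exp (Real.log γ * w) := by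
      rw [mul_comm, Real.exp_nat_mul, Real.exp_log hγ₀]
    have h2 : Real.exp (-κ) / (T : ℝ) ^ 3 = Real.exp (-κ - 3 * Real.log T) := by
      rw [Real.exp_sub, mul_comm, Real.exp_mul, Real.exp_log (by linarith)]
      norm_cast
    rw [h1, h2, Real.exp_le_exp]
    have h3 : -Real.log γ * (c * x) ≤ -Real.log γ * w := by gcongr
    have h4 : -Real.log γ * (c * x) = 3 * x := by
      rw [hc, ← mul_assoc, mul_div_cancel₀ _ hlog.ne']
    linarith
  have hfin : ((T : ℝ) + 1) ^ 2 * (γ ^ w * (1 + T * θ)) ≤ 8 * θ * Real.exp (-κ) := by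
    have h1 : (T : ℝ) + 1 ≤ 2 * T := by linarith
    have h2 : 1 + T * θ ≤ 2 * (T * θ) := by nlinarith
    calc ((T : ℝ) + 1) ^ 2 * (γ ^ w * (1 + T * θ))
        ≤ (2 * T) ^ 2 * (Real.exp (-κ) / T ^ 3 * (2 * (T * θ))) := by gcongr
      _ = 8 * θ * Real.exp (-κ) := by field_simp; ring
  have hcompl : 1 - (PoSLC.executionLaw β ρ T).real
      {e | ¬ PoSLC.PivotDense (PoSLC.walk PoSLC.countStep e) T w} =
      (PoSLC.executionLaw β ρ T).real
        {e | PoSLC.PivotDense (PoSLC.walk PoSLC.countStep e) T w} := by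
    rw [← MeasureTheory.probReal_compl_eq_one_sub MeasurableSet.of_discrete]
    congr 1
    ext e
    simp
  calc 1 - 8 * θ * Real.exp (-κ) ≤ (PoSLC.executionLaw β ρ T).real
        {e | PoSLC.PivotDense (PoSLC.walk PoSLC.countStep e) T w} := by linarith
    _ ≤ _ := by
      refine MeasureTheory.measureReal_mono fun e he => ?_
      exact PoSLC.safeAndLive_of_pivotDense _ hhash rfl hΔh hbw hw0 hK hconf' hlive' he
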